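/- Let $k\ge 1$, $m\ge 1$, $n\ge 1$, let $\pi:E\to M$ be a smooth fibre bundle over an $m$-dimensional manifold $M$ with $n$-dimensional fibres, let $\eta$ be a volume form on $M$, and let $L:J^k\pi\to\mathbb R$ be a smooth function (the Lagrangian) on the manifold of $k$-jets of local sections of $\pi$. Adapted coordinates $(x^i,u^\alpha)$ on $E$ induce coordinates $(x^i,u^\alpha_J)_{0\le|J|\le k}$ on $J^k\pi$, where $J$ runs over multi-indices in $\mathbb N^m$ and $u^\alpha_J(j^k_p\phi)=\partial^{|J|}\phi^\alpha/\partial x^J(p)$. The Lagrangian $L$ is called regular if, for every system of adapted coordinates, the matrix $$\left(\frac{\partial^2L}{\partial u^\beta_J\,\partial u^\alpha_K}\right)_{|J|=|K|=k}$$ is non-degenerate at every point of its domain in $J^k\pi$. Let $\Lambda^m_2(J^{k-1}\pi)$ be the bundle over $J^{k-1}\pi$ of those $m$-forms that vanish when two of their arguments are vertical over $M$ (with $J^0\pi=E$), let $\Theta$ be its tautological $m$-form and $\Omega=-d\Theta$. On $W_0=J^k\pi\times_{J^{k-1}\pi}\Lambda^m_2(J^{k-1}\pi)$ consider the pairing $\Phi(j^k_p\phi,\omega)=a$,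 where $a\,\eta(p)=(j^{k-1}\phi)^*\omega$ at $p$, the function $H_0=\Phi-L\circ\mathrm{pr}_1$, and the $(m+1)$-form $\Omega_{H_0}=\Omega+dH_0\wedge\eta$, where $\Omega$ and $\eta$ also denote their pullbacks to $W_0$. Let $W_1$ be the set of all $w\in W_0$ for which there is a linear map $\mathbf h:T_wW_0\to T_wW_0$ such that $\mathbf h^2=\mathbf h$, $\ker\mathbf h$ is the space of vectors vertical over $M$, and $i_{\mathbf h}\Omega_{H_0}(w)=(m-1)\Omega_{H_0}(w)$, where $(i_{\mathbf h}\Omega_{H_0})(v_0,\dots,v_m)=\sum_a\Omega_{H_0}(v_0,\dots,\mathbf h v_a,\dots,v_m)$. Let $W_2=\{w\in W_1: H_0(w)=0\}$, a submanifold of $W_0$, and let $\Omega_2$ be the pullback of $\Omega_{H_0}$ to $W_2$ by the inclusion. Suppose that $m=\dim M>1$. Then $\Omega_2$ is multisymplectic, that is, it has trivial kernel (for every $w\in W_2$, if $v\in T_wW_2$ and $i_v\Omega_2=0$, then $v=0$), if and only if $L$ is regular. -/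

import Mathlib

set_option maxSynthPendingDepth 3

open scoped Manifold ContDiff Topology

noncomputable section

namespace SkinnerRusk

/-! ### Model spaces, multi-indices, partial derivatives -/

/-- Model space of the `m`-dimensional base `M`, with coordinates `(xⁱ)`. -/
abbrev Base (m : ℕ) : Type := EuclideanSpace ℝ (Fin m)

/-- Model space of the `n`-dimensional fibres, with coordinates `(uᵅ)`. -/
abbrev Fib (n : ℕ) : Type := EuclideanSpace ℝ (Fin n)

/-- The coordinate vector `∂/∂xⁱ`. -/
abbrev dx {m : ℕ} (i : Fin m) : Base m := EuclideanSpace.single i (1 : ℝ)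

/-- Multi-indices `I ∈ ℕᵐ` of length `|I| ≤ l`. -/
def MultiIdx (m l : ℕ) : Type := {I : Fin m → ℕ // ∑ i, I i ≤ l}

instance (m l : ℕ) : DecidableEq (MultiIdx m l) :=
  inferInstanceAs (DecidableEq {I : Fin m → ℕ // ∑ i, I i ≤ l})

theorem MultiIdx.apply_le {m l : ℕ} (I : MultiIdx m l) (i : Fin m) : I.1 i ≤ l :=
  (Finset.single_le_sum (fun _ _ => Nat.zero_le _) (Finset.mem_univ i)).trans I.2

instance (m l : ℕ) : Fintype (MultiIdx m l) :=
  Fintype.ofInjective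
    (fun I : MultiIdx m l => fun i : Fin m =>
      (⟨I.1 i, Nat.lt_succ_of_le (I.apply_le i)⟩ : Fin (l + 1)))
    (fun _ _ h => Subtype.ext (funext fun i => congrArg Fin.val (congrFun h i)))

/-- The multi-index `0`. -/
def MultiIdx.zero (m l : ℕ) : MultiIdx m l := ⟨fun _ => 0, by simp⟩

/-- A multi-index of length `≤ r`, seen as one of length `≤ r + 1`. -/
def MultiIdx.incl {m r : ℕ} (I : MultiIdx m r) : MultiIdx m (r + 1) :=
  ⟨I.1, I.2.trans (Nat.le_succ r)⟩

/-- The multi-index `I + 1ᵢ`. -/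
def MultiIdx.addOne {m r : ℕ} (I : MultiIdx m r) (i : Fin m) : MultiIdx m (r + 1) :=
  ⟨fun j => I.1 j + if j = i then 1 else 0, by
    have h := I.2
    simp only [Finset.sum_add_distrib, Finset.sum_ite_eq', Finset.mem_univ, if_true]
    omega⟩

/-- Multi-indices `K` of length exactly `l`. -/
abbrev TopIdx (m l : ℕ) : Type := {K : MultiIdx m l // ∑ i, K.1 i = l}

section Partial

variable {m : ℕ} {G : Type*} [NormedAddCommGroup G] [NormedSpace ℝ G]

/-- The partial derivative `∂f/∂xⁱ`. -/
def partialDeriv (i : Fin m) (f : Base m → G) : Base m → G := fun x => fderiv ℝ f x (dx i)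

/-- The iterated partial derivative `∂^{|I|} f / (∂x₁^{I(1)} ⋯ ∂xₘ^{I(m)})`. -/
def multiDeriv (I : Fin m → ℕ) (f : Base m → G) : Base m → G :=
  (List.finRange m).foldr (fun i g => (partialDeriv i)^[I i] g) f

end Partial

/-! ### Fibre bundles, adapted charts, volume forms -/

/-- `π : E → M` is a smooth fibre bundle with typical fibre the manifold `F`: it is locally
trivial, through diffeomorphisms `π⁻¹(U) ≅ U × F` over `U`. -/
def IsSmoothFiberBundle {m n : ℕ} {M E : Type*} [TopologicalSpace M] [ChartedSpace (Base m) M]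
    [TopologicalSpace E] [ChartedSpace (Base m × Fib n) E]
    (F : Type*) [TopologicalSpace F] [ChartedSpace (Fib n) F] (π : E → M) : Prop :=
  ∀ p : M, ∃ t : Bundle.Trivialization F π, p ∈ t.baseSet ∧
    ContMDiffOn 𝓘(ℝ, Base m × Fib n) (𝓘(ℝ, Base m).prod 𝓘(ℝ, Fib n)) ∞ t t.source ∧
    ContMDiffOn (𝓘(ℝ, Base m).prod 𝓘(ℝ, Fib n)) 𝓘(ℝ, Base m × Fib n) ∞
      t.toOpenPartialHomeomorph.symm t.target

/-- An adapted coordinate system `(xⁱ, uᵅ)` of `π : E → M`: a smooth chart `(xⁱ, uᵅ)` of `E` and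
a smooth chart `(xⁱ)` of `M` such that the `xⁱ` of `y ∈ E` are the `xⁱ` of `π y`. -/
structure AdaptedChart {M E : Type*} [TopologicalSpace M] [TopologicalSpace E] (m n : ℕ)
    [ChartedSpace (Base m) M] [ChartedSpace (Base m × Fib n) E] (π : E → M) where
  base : OpenPartialHomeomorph M (Base m)
  total : OpenPartialHomeomorph E (Base m × Fib n)
  base_mem : base ∈ IsManifold.maximalAtlas 𝓘(ℝ, Base m) ∞ M
  total_mem : total ∈ IsManifold.maximalAtlas 𝓘(ℝ, Base m × Fib n) ∞ E
  mem_base : ∀ y ∈ total.source, π y ∈ base.source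
  fst_eq : ∀ y ∈ total.source, (total y).1 = base (π y)

/-- The expression in the chart `c` of `M` of a field of `m`-forms on the `m`-manifold `M`. -/
def formInChart {m : ℕ} {M : Type*} [TopologicalSpace M] [ChartedSpace (Base m) M]
    (η : ∀ p : M, (TangentSpace 𝓘(ℝ, Base m) p) [⋀^Fin m]→L[ℝ] ℝ)
    (c : OpenPartialHomeomorph M (Base m)) (y : Base m) : Base m [⋀^Fin m]→L[ℝ] ℝ :=
  (η (c.symm y)).compContinuousLinearMap
    (mfderiv 𝓘(ℝ, Base m) 𝓘(ℝ, Base m) c.symm y :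
      Base m →L[ℝ] TangentSpace 𝓘(ℝ, Base m) (c.symm y))

/-- A volume form on the `m`-manifold `M`: a smooth nowhere vanishing `m`-form. -/
structure VolumeForm (m : ℕ) (M : Type*) [TopologicalSpace M] [ChartedSpace (Base m) M] where
  form : ∀ p : M, (TangentSpace 𝓘(ℝ, Base m) p) [⋀^Fin m]→L[ℝ] ℝ
  ne_zero : ∀ p, form p ≠ 0
  smooth : ∀ c ∈ IsManifold.maximalAtlas 𝓘(ℝ, Base m) ∞ M,
    ContDiffOn ℝ ∞ (formInChart form c) c.target

/-! ### Jets of local sections -/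

/-- A smooth local section of `π` around `p`. Only the germ of `toFun` at `p` matters. -/
structure LocalSection {M E : Type*} [TopologicalSpace M] [TopologicalSpace E] (m n : ℕ)
    [ChartedSpace (Base m) M] [ChartedSpace (Base m × Fib n) E] (π : E → M) (p : M) where
  toFun : M → E
  smooth : ∀ᶠ q in 𝓝 p, ContMDiffAt 𝓘(ℝ, Base m) 𝓘(ℝ, Base m × Fib n) ∞ toFun q
  isSection : ∀ᶠ q in 𝓝 p, π (toFun q) = q

section Jets

variable {M E : Type*} [TopologicalSpace M] [TopologicalSpace E] {m n : ℕ}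
  [ChartedSpace (Base m) M] [ChartedSpace (Base m × Fib n) E] {π : E → M}

/-- The components `φᵅ(x)` of a local section in an adapted chart. -/
def LocalSection.rep {p : M} (φ : LocalSection m n π p) (e : AdaptedChart m n π) :
    Base m → Fib n :=
  fun x => (e.total (φ.toFun (e.base.symm x))).2

/-- `l`-equivalence of local sections `φ`, `ψ` at `p`: `φ(p) = ψ(p)`, and in adapted coordinates
around that point all the partial derivatives of order `≤ l` coincide at `p`. -/
def LocalSection.Equiv (l : ℕ) {p : M} (φ ψ : LocalSection m n π p) : Prop :=
  φ.toFun p = ψ.toFun p ∧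
    ∀ e : AdaptedChart m n π, φ.toFun p ∈ e.total.source → ∀ I : MultiIdx m l,
      multiDeriv I.1 (φ.rep e) (e.base p) = multiDeriv I.1 (ψ.rep e) (e.base p)

/-- `l`-equivalence at a fixed point is an equivalence relation. -/
def jetSetoid (m n : ℕ) {M E : Type*} [TopologicalSpace M] [TopologicalSpace E]
    [ChartedSpace (Base m) M] [ChartedSpace (Base m × Fib n) E] (π : E → M) (l : ℕ) (p : M) :
    Setoid (LocalSection m n π p) where
  r := LocalSection.Equiv l
  iseqv :=
    { refl := fun _ => ⟨rfl, fun _ _ _ => rfl⟩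
      symm := fun h => ⟨h.1.symm, fun e he I => (h.2 e (h.1 ▸ he) I).symm⟩
      trans := fun h h' => ⟨h.1.trans h'.1, fun e he I =>
        (h.2 e he I).trans (h'.2 e (h.1 ▸ he) I)⟩ }

/-- The `l`-th jet manifold `J^l π` (as a set): all `l`-jets `j^l_p φ` of local sections. -/
def Jet (m n : ℕ) {M E : Type*} [TopologicalSpace M] [TopologicalSpace E]
    [ChartedSpace (Base m) M] [ChartedSpace (Base m × Fib n) E] (π : E → M) (l : ℕ) : Type _ :=
  Σ p : M, Quotient (jetSetoid m n π l p)

/-- The space of coordinates `(xⁱ, uᵅ_I)`, `0 ≤ |I| ≤ l`, of `J^l π`. -/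
abbrev JetCoord (m n l : ℕ) : Type := Base m × (MultiIdx m l → Fib n)

/-- The open set of those `(xⁱ, uᵅ_I)` that are coordinates of jets in the domain of the
adapted chart. -/
def AdaptedChart.jetDomain (e : AdaptedChart m n π) (l : ℕ) : Set (JetCoord m n l) :=
  {z | (z.1, z.2 (MultiIdx.zero m l)) ∈ e.total.target}

/-- The coordinates `(xⁱ, uᵅ_I)` of the jet `j^l_p φ`: `xⁱ = xⁱ(p)` and
`uᵅ_I = ∂^{|I|} φᵅ / ∂x^I (p)`. -/
def LocalSection.jetCoord {p : M} (φ : LocalSection m n π p) (e : AdaptedChart m n π) (l : ℕ) :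
    JetCoord m n l :=
  (e.base p, fun I => multiDeriv I.1 (φ.rep e) (e.base p))

/-- The polynomial map `y ↦ ∑_I u_I (y - x)^I / I!`, whose partial derivatives at `x` are
the `u_I`. -/
def taylorMap {l : ℕ} (z : JetCoord m n l) (y : Base m) : Fib n :=
  ∑ I : MultiIdx m l, (∏ i, (y i - z.1 i) ^ I.1 i / ((I.1 i).factorial : ℝ)) • z.2 I

theorem taylorMap_contDiff {l : ℕ} (z : JetCoord m n l) : ContDiff ℝ ∞ (taylorMap z) := by
  unfold taylorMap
  fun_prop

theorem taylorMap_self {l : ℕ} (z : JetCoord m n l) :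
    taylorMap z z.1 = z.2 (MultiIdx.zero m l) := by
  unfold taylorMap
  rw [Finset.sum_eq_single (MultiIdx.zero m l)]
  · simp [MultiIdx.zero]
  · intro I _ hI
    have : ∃ i, I.1 i ≠ 0 := by
      by_contra! h
      exact hI (Subtype.ext (funext h))
    obtain ⟨i, hi⟩ := this
    rw [Finset.prod_eq_zero (Finset.mem_univ i) (by simp [hi]), zero_smul]
  · simp

theorem AdaptedChart.fst_mem (e : AdaptedChart m n π) {a : Base m × Fib n}
    (ha : a ∈ e.total.target) : a.1 ∈ e.base.target ∧ π (e.total.symm a) = e.base.symm a.1 := by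
  have hs := e.total.map_target ha
  have h1 := e.fst_eq _ hs
  rw [e.total.right_inv ha] at h1
  rw [h1]
  exact ⟨e.base.map_source (e.mem_base _ hs), (e.base.left_inv (e.mem_base _ hs)).symm⟩

theorem AdaptedChart.eventually_mem (e : AdaptedChart m n π) {l : ℕ} (z : JetCoord m n l)
    (hz : z ∈ e.jetDomain l) : ∀ᶠ q in 𝓝 (e.base.symm z.1),
      q ∈ e.base.source ∧ (e.base q, taylorMap z (e.base q)) ∈ e.total.target := by
  have hx : z.1 ∈ e.base.target := (e.fst_mem hz).1
  have hs := e.base.map_target hx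
  have hc : ContinuousAt (fun q => (e.base q, taylorMap z (e.base q))) (e.base.symm z.1) :=
    (e.base.continuousAt hs).prodMk
      ((taylorMap_contDiff z).continuous.continuousAt.comp (e.base.continuousAt hs))
  have ho : e.total.target ∈
      𝓝 (e.base (e.base.symm z.1), taylorMap z (e.base (e.base.symm z.1))) := by
    rw [e.base.right_inv hx, taylorMap_self]
    exact e.total.open_target.mem_nhds hz
  filter_upwards [e.base.open_source.mem_nhds hs, hc ho] with q h1 h2 using ⟨h1, h2⟩

/-- A local section whose jet has the given coordinates: the polynomial one. -/
def AdaptedChart.sectionAt (e : AdaptedChart m n π) {l : ℕ} (z : JetCoord m n l)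
    (hz : z ∈ e.jetDomain l) : LocalSection m n π (e.base.symm z.1) where
  toFun q := e.total.symm (e.base q, taylorMap z (e.base q))
  smooth := by
    filter_upwards [e.eventually_mem z hz] with q hq
    have h1 : ContMDiffAt 𝓘(ℝ, Base m) 𝓘(ℝ, Base m) ∞ e.base q :=
      contMDiffAt_of_mem_maximalAtlas e.base_mem hq.1
    have h2 : ContMDiffAt 𝓘(ℝ, Base m) 𝓘(ℝ, Base m × Fib n) ∞
        (fun y : Base m => (y, taylorMap z y)) (e.base q) :=
      (contDiff_id.prodMk (taylorMap_contDiff z)).contMDiff.contMDiffAt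
    have h3 : ContMDiffAt 𝓘(ℝ, Base m × Fib n) 𝓘(ℝ, Base m × Fib n) ∞ e.total.symm
        (e.base q, taylorMap z (e.base q)) :=
      contMDiffAt_symm_of_mem_maximalAtlas e.total_mem hq.2
    exact (h3.comp (e.base q) h2).comp q h1
  isSection := by
    filter_upwards [e.eventually_mem z hz] with q hq
    rw [(e.fst_mem hq.2).2, e.base.left_inv hq.1]

theorem multiDeriv_congr {G : Type*} [NormedAddCommGroup G] [NormedSpace ℝ G]
    (I : Fin m → ℕ) {f g : Base m → G} {x : Base m} (h : f =ᶠ[𝓝 x] g) :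
    multiDeriv I f x = multiDeriv I g x := by
  have h1 : ∀ (i : Fin m) (f g : Base m → G), f =ᶠ[𝓝 x] g →
      partialDeriv i f =ᶠ[𝓝 x] partialDeriv i g := fun i f g h => by
    filter_upwards [h.fderiv (𝕜 := ℝ)] with y hy
    simp only [partialDeriv, hy]
  have h2 : ∀ (i : Fin m) (a : ℕ) (f g : Base m → G), f =ᶠ[𝓝 x] g →
      (partialDeriv i)^[a] f =ᶠ[𝓝 x] (partialDeriv i)^[a] g := fun i a => by
    induction a with
    | zero => exact fun f g h => h
    | succ a ih => exact fun f g h => ih _ _ (h1 i f g h)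
  have h3 : ∀ s : List (Fin m), s.foldr (fun i g => (partialDeriv i)^[I i] g) f =ᶠ[𝓝 x]
      s.foldr (fun i g => (partialDeriv i)^[I i] g) g := fun s => by
    induction s with
    | nil => exact h
    | cons i s ih => exact h2 i _ _ _ ih
  exact (h3 _).eq_of_nhds

theorem multiDeriv_taylorMap {l : ℕ} (z : JetCoord m n l) (I : MultiIdx m l) :
    multiDeriv I.1 (taylorMap z) z.1 = z.2 I := by
  -- `q N a` is the `a`-th derivative of `t ^ N / N!`
  let q : ℕ → ℕ → ℝ → ℝ := fun N a t =>
    if a ≤ N then t ^ (N - a) / ((N - a).factorial : ℝ) else 0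
  have hq : ∀ N a t, HasDerivAt (q N a) (q N (a + 1) t) t := by
    intro N a t
    simp only [q]
    rcases lt_trichotomy a N with h | h | h
    · obtain ⟨d, rfl⟩ := Nat.exists_eq_add_of_lt h
      have e1 : a + d + 1 - a = d + 1 := by omega
      have e2 : a + d + 1 - (a + 1) = d := by omega
      simp only [show a ≤ a + d + 1 by omega, show a + 1 ≤ a + d + 1 by omega, if_true, e1, e2]
      have := (hasDerivAt_pow (d + 1) t).div_const (((d + 1).factorial : ℕ) : ℝ)
      have e3 : t ^ d / (d.factorial : ℝ) =
          ((d + 1 : ℕ) : ℝ) * t ^ (d + 1 - 1) / ((d + 1).factorial : ℝ) := by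
        have hd : (d.factorial : ℝ) ≠ 0 := by positivity
        have hd' : (d : ℝ) + 1 ≠ 0 := by positivity
        rw [Nat.factorial_succ]
        push_cast
        field_simp
      rw [e3]
      exact this
    · subst h
      simpa using hasDerivAt_const t (1 : ℝ)
    · simp only [show ¬ a ≤ N by omega, show ¬ a + 1 ≤ N by omega, if_false]
      exact hasDerivAt_const t (0 : ℝ)
  let P : (Fin m → ℕ) → Base m → Fib n := fun A y =>
    ∑ J : MultiIdx m l, (∏ i, q (J.1 i) (A i) (y i - z.1 i)) • z.2 J
  have hP0 : P 0 = taylorMap z := by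
    funext y
    simp [P, q, taylorMap]
  have hdiff : ∀ A, Differentiable ℝ (P A) := by
    intro A
    have hqd : ∀ N a, Differentiable ℝ (q N a) := fun N a t => (hq N a t).differentiableAt
    refine Differentiable.fun_sum fun J _ => Differentiable.smul_const ?_ _
    have h1 : ∀ i : Fin m, Differentiable ℝ
        (fun y : Base m => q (J.1 i) (A i) (y i - z.1 i)) := fun i => by
      have : Differentiable ℝ (fun y : Base m => y i - z.1 i) := by fun_prop
      exact (hqd _ _).comp this
    intro y
    exact (HasFDerivAt.finsetProd fun i _ => (h1 i y).hasFDerivAt).differentiableAt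
  have hstep : ∀ A i, partialDeriv i (P A) = P (A + Pi.single i 1) := by
    intro A i
    funext y
    rw [partialDeriv, ← (hdiff A y).lineDeriv_eq_fderiv]
    refine HasLineDerivAt.lineDeriv ?_
    unfold HasLineDerivAt
    refine HasDerivAt.fun_sum fun J _ => HasDerivAt.smul_const ?_ _
    have e1 : (fun t : ℝ => ∏ j, q (J.1 j) (A j) ((y + t • dx i : Base m) j - z.1 j)) =
        fun t => q (J.1 i) (A i) (y i + t - z.1 i) *
          ∏ j ∈ Finset.univ.erase i, q (J.1 j) (A j) (y j - z.1 j) := by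
      funext t
      rw [← Finset.mul_prod_erase _ _ (Finset.mem_univ i)]
      congr 1
      · simp
      · refine Finset.prod_congr rfl fun j hj => ?_
        have : j ≠ i := Finset.ne_of_mem_erase hj
        simp [this]
    have e2 : ∏ j, q (J.1 j) ((A + Pi.single i 1 : Fin m → ℕ) j) (y j - z.1 j) =
        q (J.1 i) (A i + 1) (y i + 0 - z.1 i) *
          ∏ j ∈ Finset.univ.erase i, q (J.1 j) (A j) (y j - z.1 j) := by
      rw [← Finset.mul_prod_erase _ _ (Finset.mem_univ i)]
      congr 1
      · simp
      · refine Finset.prod_congr rfl fun j hj => ?_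
        have : j ≠ i := Finset.ne_of_mem_erase hj
        simp [this]
    rw [e1, e2]
    refine HasDerivAt.mul_const ?_ _
    have h0 := hq (J.1 i) (A i) (y i + 0 - z.1 i)
    have h1 : HasDerivAt (fun t : ℝ => y i + t - z.1 i) 1 0 := by
      simpa using ((hasDerivAt_id (0 : ℝ)).const_add (y i)).sub_const (z.1 i)
    have h2 := h0.comp (0 : ℝ) h1
    rw [mul_one] at h2
    exact h2
  have hiter : ∀ (i : Fin m) (a : ℕ) A,
      (partialDeriv i)^[a] (P A) = P (A + Pi.single i a) := by
    intro i a
    induction a with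
    | zero => intro A; simp
    | succ a ih =>
      intro A
      rw [Function.iterate_succ_apply, hstep, ih, add_assoc, ← Pi.single_add, add_comm 1 a]
  have hfold : ∀ s : List (Fin m), s.foldr (fun i g => (partialDeriv i)^[I.1 i] g) (taylorMap z) =
      P ((s.map fun i => Pi.single i (I.1 i)).sum) := by
    intro s
    induction s with
    | nil => exact hP0.symm
    | cons i s ih =>
      rw [List.foldr_cons, ih, hiter, List.map_cons, List.sum_cons, add_comm]
  have hsum : ((List.finRange m).map fun i => Pi.single i (I.1 i)).sum = I.1 := by
    rw [← List.ofFn_eq_map, List.sum_ofFn]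
    exact Finset.univ_sum_single I.1
  rw [multiDeriv, hfold, hsum]
  simp only [P, sub_self]
  rw [Finset.sum_eq_single I]
  · simp [q]
  · intro J _ hJ
    have : ∃ i, J.1 i ≠ I.1 i := by
      by_contra! h
      exact hJ (Subtype.ext (funext h))
    obtain ⟨i, hi⟩ := this
    rw [Finset.prod_eq_zero (Finset.mem_univ i), zero_smul]
    simp only [q]
    split_ifs with h
    · rw [zero_pow (by omega), zero_div]
    · rfl
  · simp

/-- The jet of `e.sectionAt z` has the coordinates `z`. -/
theorem AdaptedChart.jetCoord_sectionAt (e : AdaptedChart m n π) {l : ℕ} (z : JetCoord m n l)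
    (hz : z ∈ e.jetDomain l) : (e.sectionAt z hz).jetCoord e l = z := by
  have hx : z.1 ∈ e.base.target := (e.fst_mem hz).1
  have hb : e.base (e.base.symm z.1) = z.1 := e.base.right_inv hx
  have hrep : (e.sectionAt z hz).rep e =ᶠ[𝓝 z.1] taylorMap z := by
    have hc := (e.base.continuousAt_symm hx).eventually (e.eventually_mem z hz)
    filter_upwards [hc, e.base.open_target.mem_nhds hx] with y hy hy'
    have h1 := e.base.right_inv hy'
    simp only [LocalSection.rep, AdaptedChart.sectionAt]
    rw [e.total.right_inv hy.2, h1]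
  refine Prod.ext hb (funext fun I => ?_)
  change multiDeriv I.1 ((e.sectionAt z hz).rep e) (e.base (e.base.symm z.1)) = z.2 I
  rw [hb, multiDeriv_congr I.1 hrep, multiDeriv_taylorMap]

/-- The jet with given coordinates. -/
def AdaptedChart.jetAt (e : AdaptedChart m n π) {l : ℕ} (z : JetCoord m n l)
    (hz : z ∈ e.jetDomain l) : Jet m n π l :=
  ⟨e.base.symm z.1, Quotient.mk _ (e.sectionAt z hz)⟩

open Classical in
/-- The coordinate expression `L(xⁱ, uᵅ_J)` of a function on `J^l π`. -/
def localRep (e : AdaptedChart m n π) {l : ℕ} (L : Jet m n π l → ℝ) (z : JetCoord m n l) : ℝ :=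
  if hz : z ∈ e.jetDomain l then L (e.jetAt z hz) else 0

/-- A function on `J^l π` is smooth if it is smooth in all adapted coordinates. -/
def IsSmoothOnJets {l : ℕ} (L : Jet m n π l → ℝ) : Prop :=
  ∀ e : AdaptedChart m n π, ContDiffOn ℝ ∞ (localRep e L) (e.jetDomain l)

/-- The coordinate vector `∂/∂uᵅ_J` of `J^l π`. -/
def du {l : ℕ} (J : MultiIdx m l) (α : Fin n) : JetCoord m n l :=
  (0, Pi.single J (EuclideanSpace.single α (1 : ℝ)))

/-- The matrix `(∂²L / ∂u^β_J ∂uᵅ_K)`, `|J| = |K| = l`, of second partial derivatives of `L` with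
respect to the velocities of highest order, at the jet with coordinates `z`. -/
def velocityHessian {l : ℕ} (e : AdaptedChart m n π) (L : Jet m n π l → ℝ) (z : JetCoord m n l) :
    Matrix (TopIdx m l × Fin n) (TopIdx m l × Fin n) ℝ :=
  Matrix.of fun A B => fderiv ℝ
    (fun z' => fderiv ℝ (localRep e L) z' (du B.1.1 B.2)) z (du A.1.1 A.2)

/-- The Lagrangian `L : J^l π → ℝ` is regular: for any system of adapted coordinates, its matrix
of second derivatives with respect to the highest-order velocities is everywhere
non-degenerate. -/
def IsRegularLagrangian {l : ℕ} (L : Jet m n π l → ℝ) : Prop :=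
  ∀ e : AdaptedChart m n π, ∀ z ∈ e.jetDomain l, (velocityHessian e L z).det ≠ 0

end Jets

/-! ### The velocity-momentum space `W₀ = J^k π ×_{J^{k-1} π} Λ^m_2(J^{k-1} π)`, with `k = r + 1`

An adapted chart of `π` gives a chart of `J^{k-1} π` with values in `JetCoord m n r`, in which the
projection to `M` is `Prod.fst`, hence a chart of `Λ^m_2(J^{k-1} π)` and one of `W₀`. These charts
cover `W₀`. The objects on `W₀` are expressed below in these charts. -/

/-- The fibre of `Λ^m_2(J^{k-1} π)` in an adapted chart: the `m`-forms on the tangent space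
of `J^{k-1} π` that vanish when two of their arguments are vertical over `M`. -/
def Lambda2 (m n r : ℕ) : Submodule ℝ (JetCoord m n r [⋀^Fin m]→L[ℝ] ℝ) where
  carrier := {θ | ∀ (v : Fin m → JetCoord m n r) (a b : Fin m), a ≠ b →
    (v a).1 = 0 → (v b).1 = 0 → θ v = 0}
  add_mem' := fun {_ _} h h' v a b hab ha hb => by
    rw [ContinuousAlternatingMap.add_apply, h v a b hab ha hb, h' v a b hab ha hb, add_zero]
  zero_mem' := fun _ _ _ _ _ _ => rfl
  smul_mem' := fun c _ h v a b hab ha hb => by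
    rw [ContinuousAlternatingMap.smul_apply, h v a b hab ha hb, smul_zero]

/-- The coordinate space of `W₀`: a point is a pair of (the coordinates of) a `k`-jet and an
element `θ` of `Λ^m_2(J^{k-1} π)` over the `(k-1)`-jet below it. -/
abbrev MixedCoord (m n r : ℕ) : Type := JetCoord m n (r + 1) × Lambda2 m n r

/-- The projection `π_{k,k-1} : J^k π → J^{k-1} π` in adapted coordinates. -/
def jetProj (m n r : ℕ) : JetCoord m n (r + 1) →L[ℝ] JetCoord m n r :=
  (ContinuousLinearMap.fst ℝ (Base m) (MultiIdx m (r + 1) → Fib n)).prod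
    ((ContinuousLinearMap.pi fun I : MultiIdx m r =>
      ContinuousLinearMap.proj (R := ℝ) (φ := fun _ : MultiIdx m (r + 1) => Fib n) I.incl).comp
      (ContinuousLinearMap.snd ℝ (Base m) (MultiIdx m (r + 1) → Fib n)))

/-- The projection `W₀ → J^{k-1} π` in adapted coordinates. -/
def mixedProj (m n r : ℕ) : MixedCoord m n r →L[ℝ] JetCoord m n r :=
  (jetProj m n r).comp (ContinuousLinearMap.fst ℝ (JetCoord m n (r + 1)) (Lambda2 m n r))

/-- The projection `W₀ → M` in adapted coordinates. -/
def mixedBase (m n r : ℕ) : MixedCoord m n r →L[ℝ] Base m :=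
  (ContinuousLinearMap.fst ℝ (Base m) (MultiIdx m (r + 1) → Fib n)).comp
    (ContinuousLinearMap.fst ℝ (JetCoord m n (r + 1)) (Lambda2 m n r))

/-- The canonical (tautological) `m`-form `Θ` of `Λ^m_2(J^{k-1} π)`, pulled back to `W₀`: at a
point with momentum `θ` it is the pullback of `θ`, that is `p dᵐx + p^{I,i}_α duᵅ_I ∧ dᵐ⁻¹xᵢ`. -/
def canonicalTheta (m n r : ℕ) (w : MixedCoord m n r) : MixedCoord m n r [⋀^Fin m]→L[ℝ] ℝ :=
  (w.2 : JetCoord m n r [⋀^Fin m]→L[ℝ] ℝ).compContinuousLinearMap (mixedProj m n r)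

/-- The canonical `(m+1)`-form `Ω = -dΘ = -dp ∧ dᵐx - dp^{I,i}_α ∧ duᵅ_I ∧ dᵐ⁻¹xᵢ` on `W₀`. -/
def canonicalOmega (m n r : ℕ) (w : MixedCoord m n r) : MixedCoord m n r [⋀^Fin (m + 1)]→L[ℝ] ℝ :=
  -extDeriv (canonicalTheta m n r) w

/-- The vectors `∂/∂xⁱ + uᵅ_{I+1ᵢ} ∂/∂uᵅ_I` (`|I| ≤ k - 1`): the images of `∂/∂xⁱ` under the
differential at `p` of the prolongation `j^{k-1} φ`, where `z` are the coordinates of `j^k_p φ`. -/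
def holonomicLift {m n r : ℕ} (z : JetCoord m n (r + 1)) (i : Fin m) : JetCoord m n r :=
  (dx i, fun I => z.2 (I.addOne i))

section SkinnerRuskForm

variable {M E : Type*} [TopologicalSpace M] [TopologicalSpace E] {m n r : ℕ}
  [ChartedSpace (Base m) M] [ChartedSpace (Base m × Fib n) E] {π : E → M}

/-- The domain of the chart of `W₀` given by an adapted chart. -/
def AdaptedChart.mixedDomain (e : AdaptedChart m n π) (r : ℕ) : Set (MixedCoord m n r) :=
  {w | w.1 ∈ e.jetDomain (r + 1)}

/-- The pairing `Φ(j^k_p φ, θ) = a`, where `a η = (j^{k-1} φ)^* θ` at `p`. -/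
def pairing (e : AdaptedChart m n π) (η : VolumeForm m M) (w : MixedCoord m n r) : ℝ :=
  (w.2 : JetCoord m n r [⋀^Fin m]→L[ℝ] ℝ) (holonomicLift w.1) /
    formInChart η.form e.base w.1.1 (fun i => dx i)

/-- The dynamical function `H₀ = Φ - L ∘ pr₁` on `W₀`. -/
def hamiltonian (e : AdaptedChart m n π) (η : VolumeForm m M) (L : Jet m n π (r + 1) → ℝ)
    (w : MixedCoord m n r) : ℝ :=
  pairing e η w - localRep e L w.1

/-- The `(m+1)`-form `Ω_{H₀} = Ω + dH₀ ∧ η` on `W₀`. The wedge product of the `1`-form `dH₀` and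
the `m`-form `η` is `(v₀, …, vₘ) ↦ ∑ᵢ (-1)ⁱ dH₀(vᵢ) η(v₀, …, v̂ᵢ, …, vₘ)`. -/
def omegaH (e : AdaptedChart m n π) (η : VolumeForm m M) (L : Jet m n π (r + 1) → ℝ)
    (w : MixedCoord m n r) : MixedCoord m n r [⋀^Fin (m + 1)]→L[ℝ] ℝ :=
  canonicalOmega m n r w +
    ContinuousAlternatingMap.alternatizeUncurryFin
      ((fderiv ℝ (hamiltonian e η L) w).smulRight
        ((formInChart η.form e.base w.1.1).compContinuousLinearMap (mixedBase m n r)))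

/-- `W₁`: the points `w` of `W₀` where there is a linear projector `h` of `T_w W₀` whose kernel
is the vertical space over `M` and which solves `i_h Ω_{H₀} = (m - 1) Ω_{H₀}`. -/
def W1 (e : AdaptedChart m n π) (η : VolumeForm m M) (L : Jet m n π (r + 1) → ℝ) :
    Set (MixedCoord m n r) :=
  {w | w ∈ e.mixedDomain r ∧ ∃ h : MixedCoord m n r →ₗ[ℝ] MixedCoord m n r,
    (∀ v, h (h v) = h v) ∧ (∀ v, h v = 0 ↔ mixedBase m n r v = 0) ∧
    ∀ v : Fin (m + 1) → MixedCoord m n r,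
      ∑ a, omegaH e η L w (Function.update v a (h (v a))) = ((m : ℝ) - 1) * omegaH e η L w v}

/-- `W₂ = {w ∈ W₁ : H₀(w) = 0}`. -/
def W2 (e : AdaptedChart m n π) (η : VolumeForm m M) (L : Jet m n π (r + 1) → ℝ) :
    Set (MixedCoord m n r) :=
  {w | w ∈ W1 e η L ∧ hamiltonian e η L w = 0}

/-- The tangent vectors at `w` to a submanifold `S` of a vector space: the velocities at `w` of
the smooth curves in `S` through `w`. -/
def tangentVectors {V : Type*} [NormedAddCommGroup V] [NormedSpace ℝ V] (S : Set V) (w : V) :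
    Set V :=
  {v | ∃ γ : ℝ → V, ContDiffAt ℝ ∞ γ 0 ∧ γ 0 = w ∧ HasDerivAt γ v 0 ∧ ∀ᶠ t in 𝓝 0, γ t ∈ S}

/-- The pullback `Ω₂` of `Ω_{H₀}` to `W₂` is multisymplectic, that is, it has trivial kernel:
at each point `w` of `W₂`, a vector `v ∈ T_w W₂` with `Ω_{H₀}(v, v₁, …, vₘ) = 0` for all
`v₁, …, vₘ ∈ T_w W₂` is zero. -/
def IsMultisymplecticOmega2 (η : VolumeForm m M) (L : Jet m n π (r + 1) → ℝ) : Prop :=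
  ∀ e : AdaptedChart m n π, ∀ w ∈ W2 e η L, ∀ v ∈ tangentVectors (W2 e η L) w,
    (∀ v' : Fin m → MixedCoord m n r, (∀ a, v' a ∈ tangentVectors (W2 e η L) w) →
      omegaH e η L w (Fin.cons v v') = 0) → v = 0

end SkinnerRuskForm

end SkinnerRusk

end

open SkinnerRusk
open scoped Manifold ContDiff

/-!
In an adapted chart write `θ = p dᵐx + p^{I,i}_α duᵅ_I ∧ dᵐ⁻¹xᵢ` for an element of `Λ^m_2` and
`η = ρ dᵐx`. Then `ρ H₀ = p + p^{I,i}_α uᵅ_{I+1ᵢ} - ρ L`. Regularity and the multisymplectic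
property are both statements about all adapted charts, and they are equivalent chart by chart.

*The constraints.* Contracting `i_h Ω_{H₀} = (m - 1) Ω_{H₀}` with the velocities of highest order
gives `∂H₀/∂uᵅ_J = 0`, that is `∑_{I+1ᵢ=J} p^{I,i}_α = ρ ∂L/∂uᵅ_J`, for `|J| = k`. Conversely these
equations suffice for the existence of `h`, since the remaining conditions only prescribe the
horizontal lift of `TM` along holonomic directions and the trace of its momentum components. Hence
`W₂` is cut out of `W₀` by these equations and `H₀ = 0` (`mem_W2_iff`).

*The tangent space.* The map `θ ↦ ∑_{I+1ᵢ=J} p^{I,i}_α` has a right inverse (`momentumLift`) and `p`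
enters `ρ H₀` with coefficient `1`, so there is a smooth map of `W₀` to `W₂` that only
changes momenta and is the identity on `W₂`. It produces enough curves to identify the
tangent vectors of `W₂` with the solutions of the linearized constraints
(`mem_tangentVectors_W2_iff`). The Hessian of `L` enters only through the linearization along
velocities of highest order (`fderiv_momentumConstraint`).

*The kernel.* On `W₂` the form `Ω_{H₀}` restricts to `Ω = -dΘ`, and for vectors `v` that are
vertical over `J^{k-1} π` one has `i_v Ω = -θ̇`, where `θ̇` is the momentum component of `v`
(`omegaH_cons_of_tangent`).
If the Hessian is degenerate, a null vector of it is a nonzero tangent vector with `θ̇ = 0`, vertical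
over `J^{k-1} π`, so it lies in the kernel. If the Hessian is invertible, every momentum is, up to a
multiple of `dᵐx`, the momentum component of a tangent vector that is vertical over `J^{k-1} π`.
Pairing a kernel vector `v` with these shows that all momenta, up to multiples of `dᵐx`, vanish on
tuples that contain the projection of `v` to `J^{k-1} π`. As `m > 1`, the momenta `du ∧ dᵐ⁻¹xᵢ`
with `i ≠ j` see its components `ẋʲ`, and then those over frames see its components `u̇ᵅ_I`. So `v`
is vertical over `J^{k-1} π`, hence `θ̇ = 0`, and what is left of `v` is a null vector of the Hessian
(`eq_zero_of_mem_kernel`).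
-/

noncomputable section

open scoped Topology

namespace SkinnerRusk

/-! ### Alternating forms and projectors -/

section Alternating

variable {V : Type*} [NormedAddCommGroup V] [NormedSpace ℝ V] {m : ℕ}

/-- The value of the alternatization of `f` on `(v, v')`: the terms in which `v` is not the linear
argument are written with `v` in the place of the argument that it replaces, which absorbs the
signs. -/
theorem alternatizeUncurryFin_cons (f : V →L[ℝ] V [⋀^Fin m]→L[ℝ] ℝ) (v : V) (v' : Fin m → V) :
    ContinuousAlternatingMap.alternatizeUncurryFin f (Fin.cons v v') =
      f v v' - ∑ a, f (v' a) (Function.update v' a v) := by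
  rw [ContinuousAlternatingMap.alternatizeUncurryFin_apply, Fin.sum_univ_succ, sub_eq_add_neg,
    ← Finset.sum_neg_distrib]
  congr 1
  · simp
  · refine Finset.sum_congr rfl fun a _ => ?_
    obtain _ | m := m
    · exact a.elim0
    have h1 : a.succ.removeNth (Fin.cons v v' : Fin (m + 2) → V) =
        Matrix.vecCons v (a.removeNth v') := by
      funext j
      refine Fin.cases ?_ (fun j => ?_) j <;> simp [Fin.removeNth]
    have h2 : Function.update v' a v = a.insertNth v (a.removeNth v') := by simp
    rw [h1, h2, ← ContinuousAlternatingMap.neg_one_pow_smul_map_insertNth, Fin.cons_succ,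
      Fin.val_succ, pow_succ, smul_smul, mul_right_comm, ← pow_add, Even.neg_one_pow ⟨_, rfl⟩]
    simp

theorem extDeriv_of_linear (T : V →L[ℝ] V [⋀^Fin m]→L[ℝ] ℝ) {Θ : V → V [⋀^Fin m]→L[ℝ] ℝ}
    (h : ∀ x, Θ x = T x) (x : V) :
    extDeriv Θ x = ContinuousAlternatingMap.alternatizeUncurryFin T := by
  rw [extDeriv, funext h, T.fderiv]

theorem alternatizeUncurryFin_eq_zero_of_three {p : V → Prop}
    (f : V →L[ℝ] V [⋀^Fin m]→L[ℝ] ℝ)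
    (hf : ∀ x (v : Fin m → V) (a b : Fin m), a ≠ b → p (v a) → p (v b) → f x v = 0)
    (v : Fin (m + 1) → V) (s : Finset (Fin (m + 1))) (hs : 2 < s.card) (hv : ∀ a ∈ s, p (v a)) :
    ContinuousAlternatingMap.alternatizeUncurryFin f v = 0 := by
  rw [ContinuousAlternatingMap.alternatizeUncurryFin_apply]
  refine Finset.sum_eq_zero fun i _ => ?_
  have h1 : 1 < (s.erase i).card := by
    have := Finset.pred_card_le_card_erase (s := s) (a := i)
    omega
  obtain ⟨a, ha, b, hb, hab⟩ := Finset.one_lt_card.1 h1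
  obtain ⟨a, rfl⟩ := Fin.exists_succAbove_eq (Finset.ne_of_mem_erase ha)
  obtain ⟨b, rfl⟩ := Fin.exists_succAbove_eq (Finset.ne_of_mem_erase hb)
  rw [hf _ _ a b (fun h => hab (by rw [h])) (hv _ (Finset.mem_of_mem_erase ha))
    (hv _ (Finset.mem_of_mem_erase hb)), smul_zero]

/-- An `(m + 1)`-form `Ψ` satisfies `i_h Ψ = (m - 1) Ψ` for a projector `h` as soon as it vanishes
on all tuples of vectors in the range or the kernel of `h`, except possibly those with exactly two
vectors in the kernel: on a tuple with `q` vectors in the range, `i_h` multiplies by `q`. -/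
theorem sum_update_projector (Ψ : V [⋀^Fin (m + 1)]→L[ℝ] ℝ) (h : V →ₗ[ℝ] V)
    (hh : ∀ v, h (h v) = h v)
    (h0 : ∀ v : Fin (m + 1) → V, Ψ (fun a => h (v a)) = 0)
    (h1 : ∀ (v : V) (v' : Fin m → V), h v = 0 → Ψ (Fin.cons v fun a => h (v' a)) = 0)
    (h3 : ∀ (v : Fin (m + 1) → V) (s : Finset (Fin (m + 1))), 2 < s.card →
      (∀ a ∈ s, h (v a) = 0) → Ψ v = 0)
    (v : Fin (m + 1) → V) :
    ∑ a, Ψ (Function.update v a (h (v a))) = ((m : ℝ) - 1) * Ψ v := by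
  set x : Fin (m + 1) → V := fun a => h (v a) with hx
  set y : Fin (m + 1) → V := fun a => v a - h (v a) with hy
  have hky : ∀ a, h (y a) = 0 := fun a => by simp [hy, hh]
  -- the components of the arguments in the range and in the kernel of `h`
  have hv : v = x + y := by funext a; simp [hx, hy]
  have e1 : ∀ a, Ψ (Function.update v a (h (v a))) =
      ∑ s : Finset (Fin (m + 1)), if a ∈ s then Ψ (s.piecewise x y) else 0 := fun a => by
    have : Function.update v a (h (v a)) = x + Function.update y a 0 := by
      funext b
      by_cases hb : b = a
      · subst hb; simp [hx]
      · simp [hb, hx, hy]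
    rw [this, ContinuousAlternatingMap.map_add_univ]
    refine Finset.sum_congr rfl fun s _ => ?_
    split_ifs with ha
    · congr 1
      funext b
      by_cases hb : b ∈ s
      · simp [hb]
      · have : b ≠ a := fun h => hb (h ▸ ha)
        simp [hb, this]
    · refine Ψ.map_coord_zero a ?_
      simp [ha]
  have e2 : Ψ v = ∑ s : Finset (Fin (m + 1)), Ψ (s.piecewise x y) := by
    conv_lhs => rw [hv, ContinuousAlternatingMap.map_add_univ]
  simp_rw [e1]
  rw [e2, Finset.sum_comm, Finset.mul_sum]
  refine Finset.sum_congr rfl fun s _ => ?_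
  rw [← Finset.sum_filter, Finset.sum_const, nsmul_eq_mul]
  simp only [Finset.filter_univ_mem]
  have hc : s.card + sᶜ.card = m + 1 := by simp
  have hz : ∀ a ∈ sᶜ, h (s.piecewise x y a) = 0 := fun a ha => by
    rw [Finset.piecewise_eq_of_notMem _ _ _ (Finset.mem_compl.1 ha), hky]
  rcases lt_or_ge 2 sᶜ.card with hs | hs
  · rw [h3 _ _ hs hz]; simp
  interval_cases hsc : sᶜ.card
  · have : s = Finset.univ := by simpa using hsc
    subst this
    simp only [Finset.piecewise_univ, hx, h0, mul_zero]
  · obtain ⟨a, ha⟩ := Finset.card_eq_one.1 hsc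
    have has : a ∉ s := Finset.mem_compl.1 (by rw [ha]; simp)
    have hmem : ∀ b, b ≠ a → b ∈ s := fun b hb => by
      by_contra hbs
      have : b ∈ sᶜ := Finset.mem_compl.2 hbs
      rw [ha] at this
      exact hb (Finset.mem_singleton.1 this)
    have : s.piecewise x y = a.insertNth (y a) fun j => h (v (a.succAbove j)) := by
      funext b
      by_cases hb : b = a
      · subst hb; simp [has]
      · obtain ⟨c, rfl⟩ := Fin.exists_succAbove_eq hb
        simp [hmem _ hb, hx]
    rw [this, ContinuousAlternatingMap.map_insertNth]
    have := h1 (y a) (fun j => v (a.succAbove j)) (hky a)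
    rw [show Matrix.vecCons (y a) (fun j => h (v (a.succAbove j))) = Fin.cons (y a)
      (fun j => h (v (a.succAbove j))) from rfl, this]
    simp
  · have : (s.card : ℝ) = m - 1 := by
      have : ((s.card + 1 : ℕ) : ℝ) = m := by congr 1; omega
      push_cast at this
      linarith
    rw [this]

end Alternating

section DetForm

variable {m : ℕ}

theorem det_updateRow_one (i : Fin m) (r : Fin m → ℝ) :
    ((1 : Matrix (Fin m) (Fin m) ℝ).updateRow i r).det = r i := by
  have := Matrix.cramer_transpose_apply (1 : Matrix (Fin m) (Fin m) ℝ) r i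
  rw [Matrix.transpose_one, Matrix.cramer_one] at this
  exact this.symm

theorem det_updateCol_one (i : Fin m) (r : Fin m → ℝ) :
    ((1 : Matrix (Fin m) (Fin m) ℝ).updateCol i r).det = r i := by
  have := Matrix.cramer_apply (1 : Matrix (Fin m) (Fin m) ℝ) r i
  rw [Matrix.cramer_one] at this
  exact this.symm

theorem alternating_eq_zero_of_dx (f : Base m [⋀^Fin m]→ₗ[ℝ] ℝ) (hf : f (fun i => dx i) = 0) :
    f = 0 := by
  have h := f.eq_smul_basis_det (EuclideanSpace.basisFun (Fin m) ℝ).toBasis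
  have h2 : (⇑(EuclideanSpace.basisFun (Fin m) ℝ).toBasis : Fin m → Base m) = fun i => dx i := by
    funext i; simp
  rw [h, h2, hf, zero_smul]

theorem alternating_eq_zero_of_card (f : Base m [⋀^Fin (m + 1)]→ₗ[ℝ] ℝ) : f = 0 := by
  ext y
  refine f.map_linearDependent y fun h => ?_
  have := h.fintype_card_le_finrank
  simp at this

end DetForm

/-! ### Momenta and velocities in coordinates -/

section Momenta

variable {m n r : ℕ}

/-- The `m`-form `φ₁ ∧ ⋯ ∧ φₘ` on the tangent space of `J^{k-1} π`. -/
def wedgeForm (φ : Fin m → (JetCoord m n r →L[ℝ] ℝ)) : JetCoord m n r [⋀^Fin m]→L[ℝ] ℝ :=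
  ({ (Matrix.detRowAlternating : (Fin m → ℝ) [⋀^Fin m]→ₗ[ℝ] ℝ) with
      cont := Continuous.matrix_det continuous_id } :
    (Fin m → ℝ) [⋀^Fin m]→L[ℝ] ℝ).compContinuousLinearMap (ContinuousLinearMap.pi φ)

theorem wedgeForm_apply (φ : Fin m → (JetCoord m n r →L[ℝ] ℝ)) (v : Fin m → JetCoord m n r) :
    wedgeForm φ v = (Matrix.of fun a j => φ j (v a)).det := rfl

/-- The coordinate `1`-form `dxʲ` on the tangent space of `J^{k-1} π`. -/
def dxForm (m n r : ℕ) (j : Fin m) : JetCoord m n r →L[ℝ] ℝ :=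
  (EuclideanSpace.proj j).comp (ContinuousLinearMap.fst ℝ (Base m) (MultiIdx m r → Fib n))

@[simp] theorem dxForm_apply (j : Fin m) (v : JetCoord m n r) : dxForm m n r j v = v.1 j := rfl

/-- The coordinate `1`-form `duᵅ_I` on the tangent space of `J^{k-1} π`. -/
def duForm (I : MultiIdx m r) (α : Fin n) : JetCoord m n r →L[ℝ] ℝ :=
  (EuclideanSpace.proj α).comp ((ContinuousLinearMap.proj (R := ℝ)
    (φ := fun _ : MultiIdx m r => Fib n) I).comp
      (ContinuousLinearMap.snd ℝ (Base m) (MultiIdx m r → Fib n)))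

@[simp] theorem duForm_apply (I : MultiIdx m r) (α : Fin n) (v : JetCoord m n r) :
    duForm I α v = v.2 I α := rfl

/-- The form `μ ∧ dᵐ⁻¹xᵢ`: the form `dᵐx` with its factor `dxⁱ` replaced by `μ`. -/
def momentumForm (i : Fin m) (μ : JetCoord m n r →L[ℝ] ℝ) : Lambda2 m n r :=
  ⟨wedgeForm (Function.update (dxForm m n r) i μ), fun v a b hab ha hb => by
    rw [wedgeForm_apply, Matrix.det_apply]
    refine Finset.sum_eq_zero fun σ _ => ?_
    have key : ∀ c : Fin m, (v c).1 = 0 → σ.symm c ≠ i →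
        Equiv.Perm.sign σ • ∏ j, Matrix.of (fun a j => Function.update (dxForm m n r) i μ j (v a))
          (σ j) j = 0 := fun c hc hci => by
      rw [Finset.prod_eq_zero (Finset.mem_univ (σ.symm c)) (by simp [hci, hc]), smul_zero]
    by_cases h : σ.symm a = i
    · exact key b hb fun h' => hab (σ.symm.injective (h.trans h'.symm))
    · exact key a ha h⟩

theorem momentumForm_apply (i : Fin m) (μ : JetCoord m n r →L[ℝ] ℝ) (v : Fin m → JetCoord m n r) :
    (momentumForm i μ : JetCoord m n r [⋀^Fin m]→L[ℝ] ℝ) v =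
      ((Matrix.of fun a j => (v a).1 j).updateCol i fun a => μ (v a)).det := by
  change wedgeForm _ v = _
  rw [wedgeForm_apply]
  congr 1
  ext a j
  by_cases h : j = i
  · subst h; simp
  · simp [h]

/-- The form `dᵐx`. -/
def volForm (m n r : ℕ) : Lambda2 m n r :=
  ⟨wedgeForm (dxForm m n r), fun v a _ _ ha _ => by
    rw [wedgeForm_apply]
    exact Matrix.det_eq_zero_of_row_eq_zero a fun j => by simp [ha]⟩

theorem volForm_apply (v : Fin m → JetCoord m n r) :
    (volForm m n r : JetCoord m n r [⋀^Fin m]→L[ℝ] ℝ) v =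
      (Matrix.of fun a j => (v a).1 j).det := rfl

theorem volForm_eq_zero {v : Fin m → JetCoord m n r} {a : Fin m} (ha : (v a).1 = 0) :
    (volForm m n r : JetCoord m n r [⋀^Fin m]→L[ℝ] ℝ) v = 0 :=
  Matrix.det_eq_zero_of_row_eq_zero a fun j => by simp [ha]

theorem volForm_eq_one {v : Fin m → JetCoord m n r} (hv : ∀ a, (v a).1 = dx a) :
    (volForm m n r : JetCoord m n r [⋀^Fin m]→L[ℝ] ℝ) v = 1 := by
  rw [volForm_apply, ← Matrix.det_one (n := Fin m)]
  congr 1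
  ext a j
  simp [hv, Matrix.one_apply, eq_comm]

/-- The value of `μ ∧ dᵐ⁻¹xᵢ` on a frame over `∂/∂x¹, …, ∂/∂xᵐ` whose `i`-th member has been
replaced by a vertical vector. -/
theorem momentumForm_update (i : Fin m) (μ : JetCoord m n r →L[ℝ] ℝ) {v : Fin m → JetCoord m n r}
    (hv : ∀ a, a ≠ i → (v a).1 = dx a) (hi : (v i).1 = 0) :
    (momentumForm i μ : JetCoord m n r [⋀^Fin m]→L[ℝ] ℝ) v = μ (v i) := by
  rw [momentumForm_apply, ← det_updateCol_one i fun a => μ (v a)]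
  congr 1
  ext a j
  by_cases hj : j = i
  · subst hj; simp
  · by_cases ha : a = i
    · subst ha; simp [hj, hi, Ne.symm hj]
    · simp [hj, hv a ha, Matrix.one_apply, eq_comm]

/-- The value of `μ ∧ dᵐ⁻¹xᵢ` on a tuple with an arbitrary `j`-th member, `j ≠ i`, a vertical `i`-th
member on which `μ` is `1`, and members over the other `∂/∂xᵃ` on which `μ` vanishes. -/
theorem momentumForm_eq_component {i j : Fin m} (hij : i ≠ j) (μ : JetCoord m n r →L[ℝ] ℝ)
    {v : Fin m → JetCoord m n r} (hv : ∀ a, a ≠ i → a ≠ j → (v a).1 = dx a ∧ μ (v a) = 0)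
    (hi : (v i).1 = 0) (hi' : μ (v i) = 1) :
    (momentumForm i μ : JetCoord m n r [⋀^Fin m]→L[ℝ] ℝ) v = (v j).1 j := by
  have h := det_updateRow_one j fun c => if c = i then μ (v j) else (v j).1 c
  rw [if_neg hij.symm] at h
  rw [momentumForm_apply, ← h]
  congr 1
  ext a c
  by_cases hc : c = i
  · subst hc
    by_cases ha : a = j
    · subst ha; simp
    · by_cases hac : a = c
      · subst hac; simp [ha, hi']
      · simp [ha, (hv a hac ha).2, hac]
  · by_cases ha : a = j
    · subst ha; simp [hc]
    · by_cases hai : a = i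
      · subst hai; simp [ha, hc, hi, Ne.symm hc]
      · simp [ha, hc, (hv a hai ha).1, Matrix.one_apply, eq_comm]

/-- An element of `Λ^m_2` is affine in vertical perturbations of its arguments. -/
theorem Lambda2.map_add_vertical (θ : Lambda2 m n r) (y s : Fin m → JetCoord m n r)
    (hs : ∀ i, (s i).1 = 0) :
    (θ : JetCoord m n r [⋀^Fin m]→L[ℝ] ℝ) (s + y) =
      (θ : JetCoord m n r [⋀^Fin m]→L[ℝ] ℝ) y +
        ∑ i, (θ : JetCoord m n r [⋀^Fin m]→L[ℝ] ℝ) (Function.update y i (s i)) := by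
  rw [ContinuousAlternatingMap.map_add_univ]
  have h : ∀ t : Finset (Fin m), 1 < t.card →
      (θ : JetCoord m n r [⋀^Fin m]→L[ℝ] ℝ) (t.piecewise s y) = 0 := fun t ht => by
    obtain ⟨a, ha, b, hb, hab⟩ := Finset.one_lt_card.1 ht
    exact θ.2 _ a b hab (by simp [ha, hs]) (by simp [hb, hs])
  have hnot : (∅ : Finset (Fin m)) ∉ Finset.univ.map
      ⟨fun i : Fin m => ({i} : Finset (Fin m)), Finset.singleton_injective⟩ := by simp
  rw [← Finset.sum_subset (Finset.subset_univ (Finset.cons ∅ _ hnot)), Finset.sum_cons,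
    Finset.sum_map]
  · simp [Finset.piecewise_singleton]
  · intro t _ ht
    refine h t ?_
    by_contra hc
    refine ht ?_
    rcases Nat.lt_or_ge 0 t.card with h0 | h0
    · obtain ⟨a, rfl⟩ := Finset.card_eq_one.1 (show t.card = 1 by omega)
      simp
    · have : t = ∅ := Finset.card_eq_zero.1 (by omega)
      simp [this]

/-- The vector `∂/∂xⁱ` on `J^{k-1} π`. -/
def dxVec (m n r : ℕ) (i : Fin m) : JetCoord m n r := (dx i, 0)

/-- The vector `∑_I uᵅ_{I+1ᵢ} ∂/∂uᵅ_I`, the vertical part of `holonomicLift`. -/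
def shift (i : Fin m) : JetCoord m n (r + 1) →ₗ[ℝ] JetCoord m n r where
  toFun s := (0, fun I => s.2 (I.addOne i))
  map_add' _ _ := by ext <;> simp
  map_smul' _ _ := by ext <;> simp

theorem shift_fst (i : Fin m) (s : JetCoord m n (r + 1)) : (shift (r := r) i s).1 = 0 := rfl

/-- The bilinear pairing `(s, θ) ↦ p^{I,i}_α s^α_{I+1ᵢ}` of velocities with momenta. -/
def momentumPairing (m n r : ℕ) : JetCoord m n (r + 1) →L[ℝ] Lambda2 m n r →L[ℝ] ℝ :=
  LinearMap.toContinuousLinearMap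
    { toFun := fun s => (∑ i, ContinuousAlternatingMap.apply ℝ (JetCoord m n r) ℝ
        (Function.update (dxVec m n r) i (shift i s))).comp (Lambda2 m n r).subtypeL
      map_add' := fun s t => by
        ext θ
        simp [Finset.sum_add_distrib]
      map_smul' := fun c s => by
        ext θ
        simp [Finset.mul_sum] }

theorem momentumPairing_apply (s : JetCoord m n (r + 1)) (θ : Lambda2 m n r) :
    momentumPairing m n r s θ = ∑ i, (θ : JetCoord m n r [⋀^Fin m]→L[ℝ] ℝ)
      (Function.update (dxVec m n r) i (shift i s)) := by
  simp [momentumPairing]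

theorem momentumPairing_add_smul (s t : JetCoord m n (r + 1)) (a : ℝ) (θ : Lambda2 m n r) :
    momentumPairing m n r (s + a • t) θ =
      momentumPairing m n r s θ + a * momentumPairing m n r t θ := by
  have h : momentumPairing m n r (s + a • t) =
      momentumPairing m n r s + a • momentumPairing m n r t :=
    ((momentumPairing m n r).map_add _ _).trans
      (congrArg _ ((momentumPairing m n r).map_smul _ _))
  rw [h]
  rfl

/-- The coefficient `p` of `dᵐx`. -/
def volComponent (m n r : ℕ) : Lambda2 m n r →L[ℝ] ℝ :=
  (ContinuousAlternatingMap.apply ℝ (JetCoord m n r) ℝ (dxVec m n r)).comp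
    (Lambda2 m n r).subtypeL

/-- The numerator of the pairing `Φ` is affine in the velocities, with linear part
`momentumPairing`. -/
theorem apply_holonomicLift (θ : Lambda2 m n r) (z : JetCoord m n (r + 1)) :
    (θ : JetCoord m n r [⋀^Fin m]→L[ℝ] ℝ) (holonomicLift z) =
      volComponent m n r θ + momentumPairing m n r z θ := by
  have : holonomicLift z = (fun i => shift i z) + dxVec m n r := by
    funext i
    ext <;> simp [holonomicLift, shift, dxVec]
  rw [this, Lambda2.map_add_vertical _ _ _ fun i => shift_fst i z, momentumPairing_apply]
  rfl

@[simp] theorem momentumPairing_volForm (s : JetCoord m n (r + 1)) :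
    momentumPairing m n r s (volForm m n r) = 0 := by
  rw [momentumPairing_apply]
  exact Finset.sum_eq_zero fun i _ => volForm_eq_zero (a := i) (by simp [shift])

@[simp] theorem volComponent_volForm : volComponent m n r (volForm m n r) = 1 :=
  volForm_eq_one fun _ => rfl

theorem momentumPairing_momentumForm_duForm (s : JetCoord m n (r + 1)) (i : Fin m)
    (I : MultiIdx m r) (α : Fin n) :
    momentumPairing m n r s (momentumForm i (duForm I α)) = s.2 (I.addOne i) α := by
  rw [momentumPairing_apply, Finset.sum_eq_single i]
  · rw [momentumForm_update]
    · simp [shift]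
    · intro a ha; simp [ha, dxVec]
    · simp [shift]
  · intro j _ hj
    rw [momentumForm_apply]
    refine Matrix.det_eq_zero_of_row_eq_zero i fun c => ?_
    by_cases hc : c = i
    · subst hc; simp [Ne.symm hj, dxVec]
    · simp [hc, Ne.symm hj, dxVec]
  · simp

/-! ### Velocities of highest order -/

/-- The vector `∑ c^α_J ∂/∂uᵅ_J`, `|J| = k`, with the given coefficients. -/
def topVec (c : TopIdx m (r + 1) × Fin n → ℝ) : JetCoord m n (r + 1) :=
  ∑ A, c A • du A.1.1 A.2

theorem topVec_fst (c : TopIdx m (r + 1) × Fin n → ℝ) : (topVec c).1 = 0 := by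
  simp [topVec, du, Prod.fst_sum]

theorem du_top_apply (B A : TopIdx m (r + 1) × Fin n) :
    (du (m := m) B.1.1 B.2).2 A.1.1 A.2 = if B = A then 1 else 0 := by
  by_cases h : B.1 = A.1
  · by_cases h2 : B.2 = A.2
    · simp [du, Prod.ext h h2]
    · simp [du, h, h2, Prod.ext_iff, Ne.symm h2]
  · have h3 : A.1.1 ≠ B.1.1 := fun h' => h (Subtype.ext h'.symm)
    simp [du, Prod.ext_iff, h, h3]

theorem topVec_snd (c : TopIdx m (r + 1) × Fin n → ℝ) (A : TopIdx m (r + 1) × Fin n) :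
    (topVec c).2 A.1.1 A.2 = c A := by
  have e : (topVec c).2 A.1.1 A.2 = duForm A.1.1 A.2 (topVec c) := rfl
  rw [e, topVec, map_sum]
  simp [du_top_apply]

theorem jetProj_du (A : TopIdx m (r + 1) × Fin n) : jetProj m n r (du A.1.1 A.2) = 0 := by
  ext I α
  · rfl
  · have : I.incl ≠ A.1.1 := fun h => by
      have h1 := A.1.2
      rw [← h] at h1
      have h2 := I.2
      simp only [MultiIdx.incl] at h1
      omega
    simp [jetProj, du, this]

theorem jetProj_topVec (c : TopIdx m (r + 1) × Fin n → ℝ) : jetProj m n r (topVec c) = 0 := by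
  rw [topVec, map_sum]
  exact Finset.sum_eq_zero fun A _ => by rw [map_smul, jetProj_du, smul_zero]

theorem eq_topVec {s : JetCoord m n (r + 1)} (hs : jetProj m n r s = 0) :
    s = topVec fun A => s.2 A.1.1 A.2 := by
  refine Prod.ext ?_ (funext fun J => ?_)
  · rw [topVec_fst]
    exact congrArg Prod.fst hs
  · rcases Nat.lt_or_ge (∑ i, J.1 i) (r + 1) with h | h
    · have h1 : ∀ t, jetProj m n r t = 0 → t.2 J = 0 := fun t ht =>
        congrFun (congrArg Prod.snd ht) ⟨J.1, Nat.le_of_lt_succ h⟩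
      rw [h1 s hs, h1 _ (jetProj_topVec _)]
    · ext α
      exact (topVec_snd (fun A => s.2 A.1.1 A.2) (⟨J, le_antisymm J.2 h⟩, α)).symm

/-- The inclusion of the `(k-1)`-jet coordinates into the `k`-jet coordinates, with vanishing
velocities of highest order. -/
def jetExt (m n r : ℕ) : JetCoord m n r →ₗ[ℝ] JetCoord m n (r + 1) where
  toFun y := (y.1, fun J => if h : ∑ i, J.1 i ≤ r then y.2 ⟨J.1, h⟩ else 0)
  map_add' y z := by
    ext J α
    · rfl
    · by_cases h : ∑ i, J.1 i ≤ r
      · simp only [h, Pi.add_apply, Prod.snd_add, dif_pos]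
        rfl
      · simp [h]
  map_smul' c y := by
    ext J α
    · rfl
    · by_cases h : ∑ i, J.1 i ≤ r
      · simp only [h, Pi.smul_apply, Prod.smul_snd, dif_pos]
        rfl
      · simp [h]

theorem jetProj_jetExt (y : JetCoord m n r) : jetProj m n r (jetExt m n r y) = y := by
  refine Prod.ext rfl (funext fun I => ?_)
  change (if h : ∑ i, I.1 i ≤ r then y.2 ⟨I.1, h⟩ else 0) = y.2 I
  rw [dif_pos I.2]
  rfl

theorem TopIdx.exists_addOne (K : TopIdx m (r + 1)) :
    ∃ p : Fin m × MultiIdx m r, p.2.addOne p.1 = K.1 := by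
  have hK := K.2
  obtain ⟨i, hi⟩ : ∃ i, K.1.1 i ≠ 0 := by
    by_contra! h
    simp [h] at hK
  have key : ∀ j, Function.update K.1.1 i (K.1.1 i - 1) j + (if j = i then 1 else 0) = K.1.1 j := by
    intro j
    by_cases hj : j = i
    · subst hj; simp; omega
    · simp [hj]
  have hsum : ∑ j, Function.update K.1.1 i (K.1.1 i - 1) j ≤ r := by
    have := Finset.sum_congr rfl fun j (_ : j ∈ Finset.univ) => key j
    rw [Finset.sum_add_distrib, hK] at this
    simp only [Finset.sum_ite_eq', Finset.mem_univ, if_true] at this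
    omega
  exact ⟨(i, ⟨_, hsum⟩), Subtype.ext (funext key)⟩

/-- A right inverse of the map that takes a momentum `θ` to the coefficients
`∑_{I+1ᵢ=J} p^{I,i}_α`, `|J| = k`, of its pairing with the velocities of highest order. -/
def momentumLift (m n r : ℕ) : (TopIdx m (r + 1) × Fin n → ℝ) →L[ℝ] Lambda2 m n r :=
  LinearMap.toContinuousLinearMap (Fintype.linearCombination ℝ fun A : TopIdx m (r + 1) × Fin n =>
    momentumForm (TopIdx.exists_addOne A.1).choose.1
      (duForm (TopIdx.exists_addOne A.1).choose.2 A.2))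

theorem momentumPairing_momentumLift (b : TopIdx m (r + 1) × Fin n → ℝ)
    (A : TopIdx m (r + 1) × Fin n) :
    momentumPairing m n r (du A.1.1 A.2) (momentumLift m n r b) = b A := by
  have h : ∀ B : TopIdx m (r + 1) × Fin n, momentumPairing m n r (du A.1.1 A.2)
      (momentumForm (TopIdx.exists_addOne B.1).choose.1
      (duForm (TopIdx.exists_addOne B.1).choose.2 B.2)) = if A = B then 1 else 0 := fun B => by
    rw [momentumPairing_momentumForm_duForm, (TopIdx.exists_addOne B.1).choose_spec, du_top_apply]
  simp [momentumLift, Fintype.linearCombination_apply, h]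

end Momenta

/-! ### Smoothness and derivatives of the Hamiltonian and of the constraints -/

section Analysis

variable {M E : Type*} [TopologicalSpace M] [TopologicalSpace E] {m n r : ℕ}
  [ChartedSpace (Base m) M] [ChartedSpace (Base m × Fib n) E] {π : E → M}

/-- A volume form does not vanish on the coordinate frame of a chart, as the differential of the
chart is invertible. -/
theorem formInChart_dx_ne_zero [IsManifold 𝓘(ℝ, Base m) ∞ M] (η : VolumeForm m M)
    {c : OpenPartialHomeomorph M (Base m)}
    (hc : c ∈ IsManifold.maximalAtlas 𝓘(ℝ, Base m) ∞ M) {y : Base m} (hy : y ∈ c.target) :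
    formInChart η.form c y (fun i => dx i) ≠ 0 := by
  intro h
  have h0 : formInChart η.form c y = 0 := by
    have := alternating_eq_zero_of_dx (formInChart η.form c y).toAlternatingMap h
    exact ContinuousAlternatingMap.toAlternatingMap_injective this
  refine η.ne_zero (c.symm y) ?_
  have hs := c.map_target hy
  have d1 : MDifferentiableAt 𝓘(ℝ, Base m) 𝓘(ℝ, Base m) c (c.symm y) :=
    (contMDiffAt_of_mem_maximalAtlas hc hs).mdifferentiableAt (by simp)
  have d2 : MDifferentiableAt 𝓘(ℝ, Base m) 𝓘(ℝ, Base m) c.symm (c (c.symm y)) :=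
    (contMDiffAt_symm_of_mem_maximalAtlas hc (c.map_source hs)).mdifferentiableAt (by simp)
  have d3 := mfderiv_comp (c.symm y) d2 d1
  have d4 : (c.symm ∘ c) =ᶠ[𝓝 (c.symm y)] id := by
    filter_upwards [c.open_source.mem_nhds hs] with q hq using c.left_inv hq
  rw [d4.mfderiv_eq, mfderiv_id, c.right_inv hy] at d3
  ext v
  have e : formInChart η.form c y (fun i => mfderiv 𝓘(ℝ, Base m) 𝓘(ℝ, Base m) c (c.symm y) (v i)) =
      η.form (c.symm y) v := by
    change η.form (c.symm y) (fun i => mfderiv 𝓘(ℝ, Base m) 𝓘(ℝ, Base m) c.symm y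
      (mfderiv 𝓘(ℝ, Base m) 𝓘(ℝ, Base m) c (c.symm y) (v i))) = _
    congr 1
    funext i
    exact (DFunLike.congr_fun d3 (v i)).symm
  rw [← e, h0]
  rfl

/-- The function `ρ` with `η = ρ dᵐx` in an adapted chart. -/
def volCoeff (e : AdaptedChart m n π) (η : VolumeForm m M) (x : Base m) : ℝ :=
  formInChart η.form e.base x (fun i => dx i)

theorem volCoeff_ne_zero [IsManifold 𝓘(ℝ, Base m) ∞ M] (e : AdaptedChart m n π)
    (η : VolumeForm m M) {l : ℕ} {z : JetCoord m n l} (hz : z ∈ e.jetDomain l) :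
    volCoeff e η z.1 ≠ 0 :=
  formInChart_dx_ne_zero η e.base_mem (e.fst_mem hz).1

theorem contDiffAt_volCoeff (e : AdaptedChart m n π) (η : VolumeForm m M) {l : ℕ}
    {z : JetCoord m n l} (hz : z ∈ e.jetDomain l) : ContDiffAt ℝ ∞ (volCoeff e η) z.1 :=
  (ContinuousAlternatingMap.apply ℝ (Base m) ℝ (fun i => dx i)).contDiff.contDiffAt.comp z.1
    ((η.smooth e.base e.base_mem).contDiffAt (e.base.open_target.mem_nhds (e.fst_mem hz).1))

theorem isOpen_jetDomain (e : AdaptedChart m n π) (l : ℕ) : IsOpen (e.jetDomain l) :=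
  e.total.open_target.preimage (by fun_prop)

variable {e : AdaptedChart m n π} {L : Jet m n π (r + 1) → ℝ}

theorem IsSmoothOnJets.contDiffAt (hL : IsSmoothOnJets L) {z : JetCoord m n (r + 1)}
    (hz : z ∈ e.jetDomain (r + 1)) : ContDiffAt ℝ ∞ (localRep e L) z :=
  (hL e).contDiffAt ((isOpen_jetDomain e _).mem_nhds hz)

theorem IsSmoothOnJets.contDiffAt_fderiv (hL : IsSmoothOnJets L) {z : JetCoord m n (r + 1)}
    (hz : z ∈ e.jetDomain (r + 1)) (s : JetCoord m n (r + 1)) :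
    ContDiffAt ℝ ∞ (fun z' => fderiv ℝ (localRep e L) z' s) z :=
  ((hL.contDiffAt hz).fderiv_right (m := ∞) (by simp)).clm_apply contDiffAt_const

theorem hamiltonian_eq (e : AdaptedChart m n π) (η : VolumeForm m M) (L : Jet m n π (r + 1) → ℝ)
    (w : MixedCoord m n r) :
    hamiltonian e η L w = (volComponent m n r w.2 + momentumPairing m n r w.1 w.2) /
      volCoeff e η w.1.1 - localRep e L w.1 := by
  rw [hamiltonian, pairing, apply_holonomicLift]
  rfl

theorem contDiffAt_hamiltonian [IsManifold 𝓘(ℝ, Base m) ∞ M]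
    (η : VolumeForm m M) (hL : IsSmoothOnJets L)
    {w : MixedCoord m n r} (hw : w ∈ e.mixedDomain r) : ContDiffAt ℝ ∞ (hamiltonian e η L) w := by
  have h : hamiltonian e η L = fun w => (volComponent m n r w.2 + momentumPairing m n r w.1 w.2) /
      volCoeff e η w.1.1 - localRep e L w.1 := funext (hamiltonian_eq e η L)
  rw [h]
  have h1 : ContDiffAt ℝ ∞ (fun w : MixedCoord m n r => volCoeff e η w.1.1) w :=
    (contDiffAt_volCoeff e η hw).comp w contDiffAt_fst.fst
  have h2 : ContDiffAt ℝ ∞ (fun w : MixedCoord m n r => localRep e L w.1) w :=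
    (hL.contDiffAt hw).comp w contDiffAt_fst
  refine (ContDiffAt.div ?_ h1 (volCoeff_ne_zero e η hw)).sub h2
  fun_prop

/-- The derivative of `H₀` in directions vertical over `M`, along which `ρ` is constant. -/
theorem fderiv_hamiltonian_of_vertical [IsManifold 𝓘(ℝ, Base m) ∞ M]
    (η : VolumeForm m M) (hL : IsSmoothOnJets L)
    {w : MixedCoord m n r} (hw : w ∈ e.mixedDomain r) {v : MixedCoord m n r} (hv : v.1.1 = 0) :
    fderiv ℝ (hamiltonian e η L) w v =
      ((v.2 : JetCoord m n r [⋀^Fin m]→L[ℝ] ℝ) (holonomicLift w.1) +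
        momentumPairing m n r v.1 w.2) / volCoeff e η w.1.1 - fderiv ℝ (localRep e L) w.1 v.1 := by
  rw [← ((contDiffAt_hamiltonian η hL hw).differentiableAt (by simp)).lineDeriv_eq_fderiv]
  refine HasLineDerivAt.lineDeriv ?_
  unfold HasLineDerivAt
  have h : (fun t : ℝ => hamiltonian e η L (w + t • v)) = fun t =>
      (volComponent m n r (w.2 + t • v.2) + momentumPairing m n r (w.1 + t • v.1) (w.2 + t • v.2)) /
        volCoeff e η w.1.1 - localRep e L (w.1 + t • v.1) := by
    funext t
    have h1 : (w + t • v).1.1 = w.1.1 := by simp [hv]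
    rw [hamiltonian_eq, h1]
    rfl
  rw [h, apply_holonomicLift]
  have h2 : HasDerivAt (fun t : ℝ => localRep e L (w.1 + t • v.1))
      (fderiv ℝ (localRep e L) w.1 v.1) 0 :=
    (((hL.contDiffAt hw).differentiableAt (by simp)).hasFDerivAt.hasLineDerivAt v.1)
  refine HasDerivAt.sub (HasDerivAt.div_const ?_ _) h2
  have h3 : (fun t : ℝ => volComponent m n r (w.2 + t • v.2) +
      momentumPairing m n r (w.1 + t • v.1) (w.2 + t • v.2)) = fun t =>
      (volComponent m n r w.2 + momentumPairing m n r w.1 w.2) +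
      t * (volComponent m n r v.2 + momentumPairing m n r w.1 v.2 + momentumPairing m n r v.1 w.2) +
      t ^ 2 * momentumPairing m n r v.1 v.2 := by
    funext t
    rw [momentumPairing_add_smul]
    simp only [map_add, map_smul, smul_eq_mul]
    ring
  rw [h3]
  have h4 := (((hasDerivAt_id' (0 : ℝ)).mul_const (volComponent m n r v.2 +
    momentumPairing m n r w.1 v.2 + momentumPairing m n r v.1 w.2)).const_add
    (volComponent m n r w.2 + momentumPairing m n r w.1 w.2)).add
    ((hasDerivAt_pow 2 (0 : ℝ)).mul_const (momentumPairing m n r v.1 v.2))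
  exact h4.congr_deriv (by simp)

/-- The left hand sides of the equations `∑_{I+1ᵢ=J} p^{I,i}_α - ρ ∂L/∂uᵅ_J = 0`, `|J| = k`,
of `W₁` in `W₀`. -/
def momentumConstraint (e : AdaptedChart m n π) (η : VolumeForm m M) (L : Jet m n π (r + 1) → ℝ)
    (w : MixedCoord m n r) (A : TopIdx m (r + 1) × Fin n) : ℝ :=
  momentumPairing m n r (du A.1.1 A.2) w.2 -
    volCoeff e η w.1.1 * fderiv ℝ (localRep e L) w.1 (du A.1.1 A.2)

theorem contDiffAt_momentumConstraint (η : VolumeForm m M) (hL : IsSmoothOnJets L)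
    {w : MixedCoord m n r} (hw : w ∈ e.mixedDomain r) :
    ContDiffAt ℝ ∞ (momentumConstraint e η L) w := by
  refine contDiffAt_pi.2 fun A => ?_
  have h1 : ContDiffAt ℝ ∞ (fun w : MixedCoord m n r => volCoeff e η w.1.1) w :=
    (contDiffAt_volCoeff e η hw).comp w contDiffAt_fst.fst
  have h2 : ContDiffAt ℝ ∞ (fun w : MixedCoord m n r =>
      fderiv ℝ (localRep e L) w.1 (du A.1.1 A.2)) w :=
    (hL.contDiffAt_fderiv hw _).comp w contDiffAt_fst
  refine ContDiffAt.sub ?_ (h1.mul h2)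
  fun_prop

open Matrix in
/-- Along the velocities of highest order the momentum constraints change by the Hessian of `L`;
the factor `ρ` is constant in these directions. -/
theorem fderiv_momentumConstraint (η : VolumeForm m M) (hL : IsSmoothOnJets L)
    {w : MixedCoord m n r} (hw : w ∈ e.mixedDomain r) (c : TopIdx m (r + 1) × Fin n → ℝ)
    (σ : Lambda2 m n r) (A : TopIdx m (r + 1) × Fin n) :
    fderiv ℝ (momentumConstraint e η L) w (topVec c, σ) A =
      momentumPairing m n r (du A.1.1 A.2) σ -
        volCoeff e η w.1.1 * (c ᵥ* velocityHessian e L w.1) A := by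
  have hd := (contDiffAt_momentumConstraint (e := e) η hL hw).differentiableAt (by simp)
  rw [← hd.lineDeriv_eq_fderiv]
  have hline := hd.hasFDerivAt.hasLineDerivAt (topVec c, σ)
  unfold HasLineDerivAt at hline
  have hA := (hasDerivAt_pi.1 hline) A
  rw [hd.lineDeriv_eq_fderiv]
  refine hA.unique ?_
  have h : (fun t : ℝ => momentumConstraint e η L (w + t • (topVec c, σ)) A) = fun t =>
      (momentumPairing m n r (du A.1.1 A.2) w.2 + t * momentumPairing m n r (du A.1.1 A.2) σ) -
        volCoeff e η w.1.1 * fderiv ℝ (localRep e L) (w.1 + t • topVec c) (du A.1.1 A.2) := by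
    funext t
    simp [momentumConstraint, topVec_fst]
  rw [h]
  have h2 : HasDerivAt (fun t : ℝ => fderiv ℝ (localRep e L) (w.1 + t • topVec c) (du A.1.1 A.2))
      ((c ᵥ* velocityHessian e L w.1) A) 0 := by
    have h3 := ((hL.contDiffAt_fderiv hw (du A.1.1 A.2)).differentiableAt
      (by simp)).hasFDerivAt.hasLineDerivAt (topVec c)
    have h4 : fderiv ℝ (fun z' => fderiv ℝ (localRep e L) z' (du A.1.1 A.2)) w.1 (topVec c) =
        (c ᵥ* velocityHessian e L w.1) A := by
      rw [topVec, map_sum]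
      simp [Matrix.vecMul, dotProduct, velocityHessian]
    rw [h4] at h3
    exact h3
  refine HasDerivAt.sub ?_ (h2.const_mul _)
  simpa using ((hasDerivAt_id (0 : ℝ)).mul_const (momentumPairing m n r (du A.1.1 A.2) σ)).const_add
    (momentumPairing m n r (du A.1.1 A.2) w.2)

end Analysis

/-! ### The form `Ω_{H₀}` and the equations of `W₁` and `W₂` -/

section Forms

variable {M E : Type*} [TopologicalSpace M] [TopologicalSpace E] {m n r : ℕ}
  [ChartedSpace (Base m) M] [ChartedSpace (Base m × Fib n) E] {π : E → M}

/-- The linear map `(ż, θ̇) ↦ pr^* θ̇`, which is the differential of the tautological form, itself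
linear in the coordinates of `W₀`. -/
def thetaLinear (m n r : ℕ) : MixedCoord m n r →L[ℝ] MixedCoord m n r [⋀^Fin m]→L[ℝ] ℝ :=
  (ContinuousAlternatingMap.compContinuousLinearMapCLM (mixedProj m n r)).comp
    ((Lambda2 m n r).subtypeL.comp
      (ContinuousLinearMap.snd ℝ (JetCoord m n (r + 1)) (Lambda2 m n r)))

theorem canonicalOmega_eq (w : MixedCoord m n r) : canonicalOmega m n r w =
    -ContinuousAlternatingMap.alternatizeUncurryFin (thetaLinear m n r) :=
  congrArg Neg.neg (extDeriv_of_linear (thetaLinear m n r) (fun _ => rfl) w)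

theorem omegaH_cons (e : AdaptedChart m n π) (η : VolumeForm m M) (L : Jet m n π (r + 1) → ℝ)
    (w v : MixedCoord m n r) (v' : Fin m → MixedCoord m n r) :
    omegaH e η L w (Fin.cons v v') =
      -((v.2 : JetCoord m n r [⋀^Fin m]→L[ℝ] ℝ) (fun b => mixedProj m n r (v' b)) -
        ∑ a, ((v' a).2 : JetCoord m n r [⋀^Fin m]→L[ℝ] ℝ)
          (fun b => mixedProj m n r (Function.update v' a v b))) +
      (fderiv ℝ (hamiltonian e η L) w v *
          formInChart η.form e.base w.1.1 (fun b => (v' b).1.1) -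
        ∑ a, fderiv ℝ (hamiltonian e η L) w (v' a) *
          formInChart η.form e.base w.1.1 (fun b => (Function.update v' a v b).1.1)) := by
  rw [omegaH, ContinuousAlternatingMap.add_apply, canonicalOmega_eq,
    ContinuousAlternatingMap.neg_apply, alternatizeUncurryFin_cons, alternatizeUncurryFin_cons]
  rfl

theorem omegaH_eq_zero_of_three (e : AdaptedChart m n π) (η : VolumeForm m M)
    (L : Jet m n π (r + 1) → ℝ) (w : MixedCoord m n r) (v : Fin (m + 1) → MixedCoord m n r)
    (s : Finset (Fin (m + 1))) (hs : 2 < s.card) (hv : ∀ a ∈ s, (v a).1.1 = 0) :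
    omegaH e η L w v = 0 := by
  rw [omegaH, ContinuousAlternatingMap.add_apply, canonicalOmega_eq,
    ContinuousAlternatingMap.neg_apply,
    alternatizeUncurryFin_eq_zero_of_three (p := fun v : MixedCoord m n r => v.1.1 = 0)
      _ _ v s hs hv,
    alternatizeUncurryFin_eq_zero_of_three (p := fun v : MixedCoord m n r => v.1.1 = 0)
      _ _ v s hs hv, neg_zero, add_zero]
  · intro x v a _ _ ha _
    change fderiv ℝ (hamiltonian e η L) w x *
      formInChart η.form e.base w.1.1 (fun b => (v b).1.1) = 0
    rw [(formInChart η.form e.base w.1.1).map_coord_zero a ha, mul_zero]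
  · intro x v a b hab ha hb
    exact x.2.2 _ a b hab ha hb

variable {e : AdaptedChart m n π} {η : VolumeForm m M} {L : Jet m n π (r + 1) → ℝ}

theorem omegaH_cons_of_top {w v : MixedCoord m n r} (h1 : jetProj m n r v.1 = 0) (h2 : v.2 = 0)
    (v' : Fin m → MixedCoord m n r) :
    omegaH e η L w (Fin.cons v v') = fderiv ℝ (hamiltonian e η L) w v *
      formInChart η.form e.base w.1.1 (fun b => (v' b).1.1) := by
  have h3 : v.1.1 = 0 := congrArg Prod.fst h1
  rw [omegaH_cons, h2, Finset.sum_eq_zero, Finset.sum_eq_zero]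
  · simp
  · intro a _
    rw [(formInChart η.form e.base w.1.1).map_coord_zero a (by simpa using h3), mul_zero]
  · intro a _
    refine ContinuousAlternatingMap.map_coord_zero _ a ?_
    rw [Function.update_self]
    exact h1

theorem momentumPairing_of_constraint {w : MixedCoord m n r}
    (hG : momentumConstraint e η L w = 0) {s : JetCoord m n (r + 1)} (hs : jetProj m n r s = 0) :
    momentumPairing m n r s w.2 = volCoeff e η w.1.1 * fderiv ℝ (localRep e L) w.1 s := by
  have h : ∀ A : TopIdx m (r + 1) × Fin n, momentumPairing m n r (du A.1.1 A.2) w.2 =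
      volCoeff e η w.1.1 * fderiv ℝ (localRep e L) w.1 (du A.1.1 A.2) :=
    fun A => sub_eq_zero.1 (congrFun hG A)
  have h2 : ∀ c : TopIdx m (r + 1) × Fin n → ℝ, momentumPairing m n r (topVec c) w.2 =
      ∑ A, c A * momentumPairing m n r (du A.1.1 A.2) w.2 := fun c => by
    have := map_sum ((momentumPairing m n r).flip w.2) (fun A => c A • du A.1.1 A.2) Finset.univ
    simp only [map_smul, smul_eq_mul] at this
    exact this
  rw [eq_topVec hs, h2]
  conv_rhs => rw [topVec, map_sum, Finset.mul_sum]
  refine Finset.sum_congr rfl fun A _ => ?_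
  rw [h, map_smul, smul_eq_mul]
  ring

/-- The momentum constraints say that `∂H₀/∂uᵅ_J = 0` for `|J| = k`, so that only the momentum
component of a vector vertical over `J^{k-1} π` contributes to the derivative of `H₀`. -/
theorem fderiv_hamiltonian_of_constraint [IsManifold 𝓘(ℝ, Base m) ∞ M] (hL : IsSmoothOnJets L)
    {w : MixedCoord m n r} (hw : w ∈ e.mixedDomain r) (hG : momentumConstraint e η L w = 0)
    {v : MixedCoord m n r} (hv : jetProj m n r v.1 = 0) :
    fderiv ℝ (hamiltonian e η L) w v =
      (v.2 : JetCoord m n r [⋀^Fin m]→L[ℝ] ℝ) (holonomicLift w.1) / volCoeff e η w.1.1 := by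
  rw [fderiv_hamiltonian_of_vertical η hL hw (congrArg Prod.fst hv),
    momentumPairing_of_constraint hG hv, add_div,
    mul_div_cancel_left₀ _ (volCoeff_ne_zero e η hw)]
  ring

/-- Contracting the equation `i_h Ω_{H₀} = (m - 1) Ω_{H₀}` with `∂/∂uᵅ_J`, `|J| = k`, gives
`m ∂H₀/∂uᵅ_J η = (m - 1) ∂H₀/∂uᵅ_J η`. -/
theorem momentumConstraint_of_mem_W1 [IsManifold 𝓘(ℝ, Base m) ∞ M] (hL : IsSmoothOnJets L)
    {w : MixedCoord m n r} (hw : w ∈ W1 e η L) : momentumConstraint e η L w = 0 := by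
  obtain ⟨hd, h, hh, hk, hO⟩ := hw
  funext A
  have hρ := volCoeff_ne_zero e η hd
  set v : MixedCoord m n r := (du A.1.1 A.2, 0) with hv
  have hv0 : v.1.1 = 0 := rfl
  set v' : Fin m → MixedCoord m n r := fun j => ((dx j, 0), 0) with hv'
  have hb : ∀ x, (h x).1.1 = x.1.1 := fun x => by
    have h1 : mixedBase m n r (h x - x) = 0 := (hk _).1 (by rw [map_sub, hh, sub_self])
    rw [(mixedBase m n r).map_sub] at h1
    exact sub_eq_zero.1 h1
  have hhv : h v = 0 := (hk v).2 hv0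
  have h1 := hO (Fin.cons v v')
  rw [Fin.sum_univ_succ] at h1
  have h2 : omegaH e η L w (Function.update (Fin.cons v v' : Fin (m + 1) → MixedCoord m n r) 0
      (h ((Fin.cons v v' : Fin (m + 1) → MixedCoord m n r) 0))) = 0 :=
    (omegaH e η L w).map_coord_zero 0 (by simp [hhv])
  have h3 : ∀ u : Fin m → MixedCoord m n r, (∀ b, (u b).1.1 = dx b) →
      omegaH e η L w (Fin.cons v u) =
        fderiv ℝ (hamiltonian e η L) w v * volCoeff e η w.1.1 := fun u hu => by
    rw [omegaH_cons_of_top (jetProj_du A) rfl]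
    simp only [hu]
    rfl
  have h4 : ∀ j : Fin m, omegaH e η L w
      (Function.update (Fin.cons v v' : Fin (m + 1) → MixedCoord m n r) j.succ
        (h ((Fin.cons v v' : Fin (m + 1) → MixedCoord m n r) j.succ))) =
        fderiv ℝ (hamiltonian e η L) w v * volCoeff e η w.1.1 := fun j => by
    rw [Fin.cons_succ, ← Fin.cons_update]
    refine h3 _ fun b => ?_
    by_cases hbj : b = j
    · subst hbj; simp [hb, hv']
    · simp [hbj, hv']
  rw [h2, Finset.sum_congr rfl fun j _ => h4 j, h3 v' fun _ => rfl] at h1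
  simp only [zero_add, Finset.sum_const, Finset.card_univ, Fintype.card_fin, nsmul_eq_mul] at h1
  have h5 : fderiv ℝ (hamiltonian e η L) w v * volCoeff e η w.1.1 = 0 := by linarith
  have h6 := (mul_eq_zero.1 h5).resolve_right hρ
  rw [fderiv_hamiltonian_of_vertical η hL hd hv0] at h6
  have h7 := mul_eq_zero_of_right (volCoeff e η w.1.1) h6
  rw [mul_sub, mul_div_cancel₀ _ hρ] at h7
  simpa [momentumConstraint, hv] using h7

/-- Under the momentum constraints a solution of `i_h Ω_{H₀} = (m - 1) Ω_{H₀}` is the projector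
onto the span of holonomic vectors `X₁, …, Xₘ` over `∂/∂x¹, …, ∂/∂xᵐ`. Only the momentum
component of one of them has to be adjusted, so that `i_{X₁} ⋯ i_{Xₘ} Ω_{H₀}` vanishes on vertical
vectors. -/
theorem mem_W1_of_momentumConstraint [IsManifold 𝓘(ℝ, Base m) ∞ M] (hm : 0 < m)
    (hL : IsSmoothOnJets L) {w : MixedCoord m n r} (hw : w ∈ e.mixedDomain r)
    (hG : momentumConstraint e η L w = 0) : w ∈ W1 e η L := by
  have hρ := volCoeff_ne_zero e η hw
  let i₀ : Fin m := ⟨0, hm⟩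
  let μ : JetCoord m n r →L[ℝ] ℝ := LinearMap.toContinuousLinearMap
    ((-volCoeff e η w.1.1) • ((fderiv ℝ (hamiltonian e η L) w).toLinearMap ∘ₗ
      LinearMap.inl ℝ (JetCoord m n (r + 1)) (Lambda2 m n r) ∘ₗ jetExt m n r))
  have hμ : ∀ y, μ y = -volCoeff e η w.1.1 * fderiv ℝ (hamiltonian e η L) w (jetExt m n r y, 0) :=
    fun y => rfl
  let X : Fin m → MixedCoord m n r := fun j =>
    (jetExt m n r (holonomicLift w.1 j), if j = i₀ then momentumForm i₀ μ else 0)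
  have hX1 : ∀ j, (X j).1.1 = dx j := fun j => rfl
  have hXp : ∀ j, mixedProj m n r (X j) = holonomicLift w.1 j := fun j => jetProj_jetExt _
  let B := (EuclideanSpace.basisFun (Fin m) ℝ).toBasis
  have hB : ∀ j, B j = dx j := fun j => by simp [B]
  let Y : Base m →ₗ[ℝ] MixedCoord m n r := B.constr ℝ X
  have hY : ∀ j, Y (dx j) = X j := fun j => by
    rw [← hB]
    exact B.constr_basis ℝ X j
  have hYb : ∀ y, mixedBase m n r (Y y) = y := fun y => by
    have : (mixedBase m n r).toLinearMap ∘ₗ Y = LinearMap.id :=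
      B.ext fun j => by
        simp only [LinearMap.comp_apply, hB, hY]
        exact hX1 j
    exact LinearMap.congr_fun this y
  let h : MixedCoord m n r →ₗ[ℝ] MixedCoord m n r := Y ∘ₗ (mixedBase m n r).toLinearMap
  have hap : ∀ v, h v = Y (mixedBase m n r v) := fun _ => rfl
  have hh : ∀ v, h (h v) = h v := fun v => by rw [hap, hap, hYb]
  have hk : ∀ v, h v = 0 ↔ mixedBase m n r v = 0 := fun v => by
    refine ⟨fun hv => ?_, fun hv => by rw [hap, hv, map_zero]⟩
    rw [← hYb (mixedBase m n r v), ← hap, hv, (mixedBase m n r).map_zero]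
  refine ⟨hw, h, hh, hk, sum_update_projector _ h hh ?_ ?_ ?_⟩
  · intro v
    exact DFunLike.congr_fun (alternating_eq_zero_of_card
      ((omegaH e η L w).toAlternatingMap.compLinearMap Y)) fun a => mixedBase m n r (v a)
  · intro v v' hv
    have hv0 : v.1.1 = 0 := (hk v).1 hv
    refine DFunLike.congr_fun (alternating_eq_zero_of_dx
      (((omegaH e η L w).toAlternatingMap.curryLeft v).compLinearMap Y) ?_)
      fun a => mixedBase m n r (v' a)
    change omegaH e η L w (Fin.cons v fun j => Y (dx j)) = 0
    simp only [hY]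
    rw [omegaH_cons]
    have e1 : ∑ a, ((X a).2 : JetCoord m n r [⋀^Fin m]→L[ℝ] ℝ)
        (fun b => mixedProj m n r (Function.update X a v b)) = μ (mixedProj m n r v) := by
      rw [Finset.sum_eq_single i₀]
      · simp only [X, if_pos]
        rw [momentumForm_update]
        · rw [Function.update_self]
        · intro a ha
          rw [Function.update_of_ne ha]
          rfl
        · rw [Function.update_self]
          exact hv0
      · intro j _ hj
        simp [X, hj]
      · simp
    have e2 : ∑ a, fderiv ℝ (hamiltonian e η L) w (X a) *
        formInChart η.form e.base w.1.1 (fun b => (Function.update X a v b).1.1) = 0 := by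
      refine Finset.sum_eq_zero fun a _ => ?_
      rw [(formInChart η.form e.base w.1.1).map_coord_zero a (by simpa using hv0), mul_zero]
    have e3 : formInChart η.form e.base w.1.1 (fun b => (X b).1.1) = volCoeff e η w.1.1 := rfl
    -- the part of `v` that `μ` does not see is a velocity of highest order
    set y := mixedProj m n r v with hy
    have e4 : fderiv ℝ (hamiltonian e η L) w v =
        fderiv ℝ (hamiltonian e η L) w (jetExt m n r y, 0) +
          (v.2 : JetCoord m n r [⋀^Fin m]→L[ℝ] ℝ) (holonomicLift w.1) / volCoeff e η w.1.1 := by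
      have hs : jetProj m n r (v - (jetExt m n r y, 0)).1 = 0 := by
        change jetProj m n r (v.1 - jetExt m n r y) = 0
        rw [map_sub, jetProj_jetExt]
        exact sub_self _
      have := fderiv_hamiltonian_of_constraint hL hw hG hs
      rw [(fderiv ℝ (hamiltonian e η L) w).map_sub,
        sub_eq_iff_eq_add'] at this
      rw [this]
      simp
    rw [e1, e2, e3, hμ, e4]
    simp only [hXp]
    field_simp
    ring
  · intro v s hs hv
    exact omegaH_eq_zero_of_three e η L w v s hs fun a ha => (hk _).1 (hv a ha)

/-- The equations of `W₂` in `W₀`. -/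
theorem mem_W2_iff [IsManifold 𝓘(ℝ, Base m) ∞ M] (hm : 0 < m) (hL : IsSmoothOnJets L)
    {w : MixedCoord m n r} : w ∈ W2 e η L ↔
      w ∈ e.mixedDomain r ∧ momentumConstraint e η L w = 0 ∧ hamiltonian e η L w = 0 :=
  ⟨fun h => ⟨h.1.1, momentumConstraint_of_mem_W1 hL h.1, h.2⟩,
    fun h => ⟨mem_W1_of_momentumConstraint hm hL h.1 h.2.1, h.2.2⟩⟩

end Forms

/-! ### Tangent vectors of `W₂` and the kernel of `Ω₂` -/

section Tangent

variable {V : Type*} [NormedAddCommGroup V] [NormedSpace ℝ V]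
  {F : Type*} [NormedAddCommGroup F] [NormedSpace ℝ F]

theorem fderiv_eq_zero_of_mem_tangentVectors {S : Set V} {w v : V} {f : V → F}
    (hf : DifferentiableAt ℝ f w) (hS : ∀ x ∈ S, f x = 0) (hv : v ∈ tangentVectors S w) :
    fderiv ℝ f w v = 0 := by
  obtain ⟨γ, -, h0, hγ, hγS⟩ := hv
  subst h0
  have h1 := hf.hasFDerivAt.comp_hasDerivAt 0 hγ
  have h2 : (f ∘ γ) =ᶠ[𝓝 0] fun _ => (0 : F) := by
    filter_upwards [hγS] with t ht using hS _ ht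
  exact h1.unique ((hasDerivAt_const (0 : ℝ) (0 : F)).congr_of_eventuallyEq h2)

/-- If the smooth map `x ↦ x - D x` takes a neighbourhood of `w` into `S` and fixes `w`, then it
takes the line `w + t v` to a curve in `S`, of velocity `v` when the derivative of `D` along the
line vanishes. -/
theorem mem_tangentVectors_of_correction {S : Set V} {w v : V} {D : V → V}
    (hD : ContDiffAt ℝ ∞ D w) (h0 : D w = 0)
    (hv : HasDerivAt (fun t : ℝ => D (w + t • v)) 0 0) (hS : ∀ᶠ x in 𝓝 w, x - D x ∈ S) :
    v ∈ tangentVectors S w := by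
  have hl : ContDiffAt ℝ ∞ (fun t : ℝ => w + t • v) 0 := by fun_prop
  have hl0 : w + (0 : ℝ) • v = w := by simp
  refine ⟨fun t => (w + t • v) - D (w + t • v), ?_, by simp [h0], ?_, ?_⟩
  · refine hl.sub (ContDiffAt.comp (0 : ℝ) ?_ hl)
    rw [hl0]
    exact hD
  · have h1 : HasDerivAt (fun t : ℝ => w + t • v) v 0 := by
      simpa using ((hasDerivAt_id' (0 : ℝ)).smul_const v).const_add w
    exact (h1.sub hv).congr_deriv (sub_zero v)
  · have hc : Filter.Tendsto (fun t : ℝ => w + t • v) (𝓝 0) (𝓝 w) := by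
      have := hl.continuousAt.tendsto
      rwa [hl0] at this
    exact hc.eventually hS

variable {Z Λ K : Type*} [NormedAddCommGroup Z] [NormedSpace ℝ Z] [NormedAddCommGroup Λ]
  [NormedSpace ℝ Λ] [NormedAddCommGroup K] [NormedSpace ℝ K]

/-- The correction `B (G w) + (ρ H - p (B (G w)) - P (w, B (G w))) ν` of the second component of a
point `w ∈ Z × Λ`. It is applied with `G = 0`, `H = 0` the equations of `W₂`, `B` a right inverse of
the linear part of `G` and `p + P` the pairing of momenta with velocities. -/
def correction (B : K →L[ℝ] Λ) (p : Λ →L[ℝ] ℝ) (P : Z →L[ℝ] Λ →L[ℝ] ℝ) (ν : Λ) (G : Z × Λ → K)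
    (H ρ : Z × Λ → ℝ) (w : Z × Λ) : Λ :=
  B (G w) + (ρ w * H w - (p (B (G w)) + P w.1 (B (G w)))) • ν

variable {B : K →L[ℝ] Λ} {p : Λ →L[ℝ] ℝ} {P : Z →L[ℝ] Λ →L[ℝ] ℝ} {ν : Λ} {G : Z × Λ → K}
  {H ρ : Z × Λ → ℝ} {w : Z × Λ}

theorem apply_correction {q : Λ →L[ℝ] ℝ} (hq : q ν = 0) :
    q (correction B p P ν G H ρ w) = q (B (G w)) := by
  simp [correction, hq]

theorem pairing_correction (hp : p ν = 1) (hP : P w.1 ν = 0) :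
    p (correction B p P ν G H ρ w) + P w.1 (correction B p P ν G H ρ w) = ρ w * H w := by
  simp only [correction, map_add, map_smul, hp, hP, smul_eq_mul]
  ring

theorem contDiffAt_correction (sG : ContDiffAt ℝ ∞ G w) (sH : ContDiffAt ℝ ∞ H w)
    (sρ : ContDiffAt ℝ ∞ ρ w) : ContDiffAt ℝ ∞ (correction B p P ν G H ρ) w := by
  have s1 : ContDiffAt ℝ ∞ (fun w => B (G w)) w := B.contDiff.contDiffAt.comp w sG
  have s2 : ContDiffAt ℝ ∞ (fun w => p (B (G w))) w := p.contDiff.contDiffAt.comp w s1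
  have s3 : ContDiffAt ℝ ∞ (fun w : Z × Λ => P w.1) w :=
    P.contDiff.contDiffAt.comp w contDiffAt_fst
  exact s1.add (((sρ.mul sH).sub (s2.add (s3.clm_apply s1))).smul contDiffAt_const)

theorem hasDerivAt_correction (sG : DifferentiableAt ℝ G w) (sH : DifferentiableAt ℝ H w)
    (sρ : DifferentiableAt ℝ ρ w) (hG : G w = 0) (hH : H w = 0) {v : Z × Λ}
    (hv1 : fderiv ℝ G w v = 0) (hv2 : fderiv ℝ H w v = 0) :
    HasDerivAt (fun t : ℝ => correction B p P ν G H ρ (w + t • v)) 0 0 := by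
  have t1 : HasDerivAt (fun t : ℝ => G (w + t • v)) 0 0 := by
    have := sG.hasFDerivAt.hasLineDerivAt v
    rwa [hv1] at this
  have t2 : HasDerivAt (fun t : ℝ => H (w + t • v)) 0 0 := by
    have := sH.hasFDerivAt.hasLineDerivAt v
    rwa [hv2] at this
  have t3 : HasDerivAt (fun t : ℝ => B (G (w + t • v))) 0 0 := by
    have := B.hasFDerivAt.comp_hasDerivAt (0 : ℝ) t1
    rwa [map_zero] at this
  have t4 : HasDerivAt (fun t : ℝ => p (B (G (w + t • v)))) 0 0 := by
    have := p.hasFDerivAt.comp_hasDerivAt (0 : ℝ) t3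
    rwa [map_zero] at this
  have t5 : HasDerivAt (fun t : ℝ => ρ (w + t • v)) (fderiv ℝ ρ w v) 0 :=
    sρ.hasFDerivAt.hasLineDerivAt v
  have t6 : HasDerivAt (fun t : ℝ => P (w + t • v).1) (P v.1) 0 := by
    refine P.hasFDerivAt.comp_hasDerivAt (0 : ℝ) ?_
    exact (((hasDerivAt_id' (0 : ℝ)).smul_const v.1).const_add w.1).congr_deriv (one_smul _ _)
  refine (t3.add (((t5.mul t2).sub (t4.add (t6.clm_apply t3))).smul_const ν)).congr_deriv ?_
  simp [hG, hH]

end Tangent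

section W2

variable {M E : Type*} [TopologicalSpace M] [TopologicalSpace E] {m n r : ℕ}
  [ChartedSpace (Base m) M] [ChartedSpace (Base m × Fib n) E] {π : E → M}
  {e : AdaptedChart m n π} {η : VolumeForm m M} {L : Jet m n π (r + 1) → ℝ}

theorem hamiltonian_sub (w : MixedCoord m n r) (θ : Lambda2 m n r) :
    hamiltonian e η L (w - (0, θ)) = hamiltonian e η L w -
      (volComponent m n r θ + momentumPairing m n r w.1 θ) / volCoeff e η w.1.1 := by
  have h1 : (w - (0, θ)).1 = w.1 := sub_zero _
  have h2 : (w - (0, θ)).2 = w.2 - θ := rfl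
  rw [hamiltonian_eq, hamiltonian_eq, h1, h2, (volComponent m n r).map_sub,
    (momentumPairing m n r w.1).map_sub]
  ring

theorem momentumConstraint_sub (w : MixedCoord m n r) (θ : Lambda2 m n r)
    (A : TopIdx m (r + 1) × Fin n) :
    momentumConstraint e η L (w - (0, θ)) A = momentumConstraint e η L w A -
      momentumPairing m n r (du A.1.1 A.2) θ := by
  have h1 : (w - (0, θ)).1 = w.1 := sub_zero _
  have h2 : (w - (0, θ)).2 = w.2 - θ := rfl
  simp only [momentumConstraint]
  rw [h1, h2, (momentumPairing m n r _).map_sub]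
  ring

/-- The change of momentum that brings a point of `W₀` into `W₂`: the first summand enforces the
momentum constraints, the second one, which does not affect them, makes `H₀` vanish. -/
def constraintCorrection (e : AdaptedChart m n π) (η : VolumeForm m M)
    (L : Jet m n π (r + 1) → ℝ) (w : MixedCoord m n r) : Lambda2 m n r :=
  correction (momentumLift m n r) (volComponent m n r) (momentumPairing m n r) (volForm m n r)
    (momentumConstraint e η L) (hamiltonian e η L) (fun w => volCoeff e η w.1.1) w

theorem momentumPairing_constraintCorrection (w : MixedCoord m n r)
    (A : TopIdx m (r + 1) × Fin n) :
    momentumPairing m n r (du A.1.1 A.2) (constraintCorrection e η L w) =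
      momentumConstraint e η L w A :=
  (apply_correction (q := momentumPairing m n r (du A.1.1 A.2)) (momentumPairing_volForm _)).trans
    (momentumPairing_momentumLift _ _)

theorem apply_constraintCorrection (w : MixedCoord m n r) :
    volComponent m n r (constraintCorrection e η L w) +
      momentumPairing m n r w.1 (constraintCorrection e η L w) =
        volCoeff e η w.1.1 * hamiltonian e η L w :=
  pairing_correction (p := volComponent m n r) volComponent_volForm (momentumPairing_volForm _)

theorem sub_constraintCorrection_mem_W2 [IsManifold 𝓘(ℝ, Base m) ∞ M]
    (hm : 0 < m) (hL : IsSmoothOnJets L)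
    {w : MixedCoord m n r} (hw : w ∈ e.mixedDomain r) :
    w - (0, constraintCorrection e η L w) ∈ W2 e η L := by
  have hρ := volCoeff_ne_zero e η hw
  have h1 : (w - (0, constraintCorrection e η L w)).1 = w.1 := sub_zero _
  refine (mem_W2_iff hm hL).2 ⟨?_, funext fun A => ?_, ?_⟩
  · change (w - (0, constraintCorrection e η L w)).1 ∈ e.jetDomain (r + 1)
    rw [h1]
    exact hw
  · rw [momentumConstraint_sub, momentumPairing_constraintCorrection]
    exact sub_self _
  · rw [hamiltonian_sub, apply_constraintCorrection, mul_div_cancel_left₀ _ hρ, sub_self]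

/-- The tangent vectors of `W₂` are the solutions of the linearized constraints. -/
theorem mem_tangentVectors_W2_iff [IsManifold 𝓘(ℝ, Base m) ∞ M] (hm : 0 < m) (hL : IsSmoothOnJets L)
    {w : MixedCoord m n r} (hw : w ∈ W2 e η L) (v : MixedCoord m n r) :
    v ∈ tangentVectors (W2 e η L) w ↔
      fderiv ℝ (momentumConstraint e η L) w v = 0 ∧ fderiv ℝ (hamiltonian e η L) w v = 0 := by
  obtain ⟨hd, hG, hH⟩ := (mem_W2_iff hm hL).1 hw
  have sG := contDiffAt_momentumConstraint (e := e) η hL hd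
  have sH := contDiffAt_hamiltonian (e := e) η hL hd
  have dG := sG.differentiableAt (by simp)
  have dH := sH.differentiableAt (by simp)
  refine ⟨fun hv => ⟨fderiv_eq_zero_of_mem_tangentVectors dG
    (fun x hx => ((mem_W2_iff hm hL).1 hx).2.1) hv, fderiv_eq_zero_of_mem_tangentVectors dH
    (fun x hx => ((mem_W2_iff hm hL).1 hx).2.2) hv⟩, fun ⟨hv1, hv2⟩ => ?_⟩
  have sρ : ContDiffAt ℝ ∞ (fun w : MixedCoord m n r => volCoeff e η w.1.1) w :=
    (contDiffAt_volCoeff e η hd).comp w contDiffAt_fst.fst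
  have dρ := sρ.differentiableAt (by simp)
  refine mem_tangentVectors_of_correction
    (D := fun w => ((0 : JetCoord m n (r + 1)), constraintCorrection e η L w))
    (contDiffAt_const.prodMk (contDiffAt_correction sG sH sρ)) ?_
    ((hasDerivAt_const (0 : ℝ) (0 : JetCoord m n (r + 1))).prodMk
      (hasDerivAt_correction dG dH dρ hG hH hv1 hv2)) ?_
  · simp [constraintCorrection, correction, hG, hH]
  · filter_upwards [((isOpen_jetDomain e (r + 1)).preimage continuous_fst).mem_nhds hd] with x hx
      using sub_constraintCorrection_mem_W2 hm hL hx

theorem exists_mem_W2 [IsManifold 𝓘(ℝ, Base m) ∞ M]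
    (hm : 0 < m) (hL : IsSmoothOnJets L) {z : JetCoord m n (r + 1)}
    (hz : z ∈ e.jetDomain (r + 1)) : ∃ w ∈ W2 e η L, w.1 = z :=
  ⟨_, sub_constraintCorrection_mem_W2 (w := (z, 0)) hm hL hz, sub_zero _⟩

theorem fderiv_momentumConstraint_momentum (hL : IsSmoothOnJets L)
    {w : MixedCoord m n r} (hw : w ∈ e.mixedDomain r) (σ : Lambda2 m n r)
    (A : TopIdx m (r + 1) × Fin n) :
    fderiv ℝ (momentumConstraint e η L) w (0, σ) A = momentumPairing m n r (du A.1.1 A.2) σ := by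
  have h : (0 : JetCoord m n (r + 1)) = topVec 0 := by simp [topVec]
  rw [h, fderiv_momentumConstraint η hL hw, Matrix.zero_vecMul]
  simp

/-- The projection of `W₂` to `J^k π` is a submersion: any velocity of the `k`-jet is completed to a
tangent vector by solving the linearized constraints for the momenta. -/
theorem exists_mem_tangentVectors_W2 [IsManifold 𝓘(ℝ, Base m) ∞ M]
    (hm : 0 < m) (hL : IsSmoothOnJets L)
    {w : MixedCoord m n r} (hw : w ∈ W2 e η L) (s : JetCoord m n (r + 1)) :
    ∃ v ∈ tangentVectors (W2 e η L) w, v.1 = s := by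
  obtain ⟨hd, hG, -⟩ := (mem_W2_iff hm hL).1 hw
  have hρ := volCoeff_ne_zero e η hd
  set τ := momentumLift m n r (fderiv ℝ (momentumConstraint e η L) w (s, 0)) with hτ
  set c := volCoeff e η w.1.1 * fderiv ℝ (hamiltonian e η L) w ((s, 0) - (0, τ)) with hc
  refine ⟨(s, 0) - (0, τ) - c • (0, volForm m n r), (mem_tangentVectors_W2_iff hm hL hw _).2
    ⟨funext fun A => ?_, ?_⟩, ?_⟩
  · rw [ContinuousLinearMap.map_sub, ContinuousLinearMap.map_sub, ContinuousLinearMap.map_smul]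
    simp only [Pi.sub_apply, Pi.smul_apply]
    rw [fderiv_momentumConstraint_momentum hL hd, fderiv_momentumConstraint_momentum hL hd,
      momentumPairing_volForm, hτ, momentumPairing_momentumLift]
    simp
  · rw [ContinuousLinearMap.map_sub, ContinuousLinearMap.map_smul,
      fderiv_hamiltonian_of_constraint hL hd hG (v := (0, volForm m n r))
        ((jetProj m n r).map_zero), apply_holonomicLift]
    simp only [volComponent_volForm, momentumPairing_volForm, hc, smul_eq_mul]
    field_simp
    ring
  · change s - 0 - c • 0 = s
    rw [smul_zero, sub_zero, sub_zero]

open Matrix in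
/-- If `L` is regular, then every momentum is, up to a multiple of `dᵐx`, the momentum component of
a vector that is tangent to `W₂` and vertical over `J^{k-1} π`. -/
theorem exists_vertical_mem_tangentVectors_W2 [IsManifold 𝓘(ℝ, Base m) ∞ M]
    (hm : 0 < m) (hL : IsSmoothOnJets L)
    {w : MixedCoord m n r} (hw : w ∈ W2 e η L) (hdet : (velocityHessian e L w.1).det ≠ 0)
    (σ : Lambda2 m n r) : ∃ v ∈ tangentVectors (W2 e η L) w, jetProj m n r v.1 = 0 ∧
      ∃ c : ℝ, v.2 = σ + c • volForm m n r := by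
  obtain ⟨hd, hG, -⟩ := (mem_W2_iff hm hL).1 hw
  have hρ := volCoeff_ne_zero e η hd
  obtain ⟨d, hd'⟩ := Matrix.vecMul_surjective_iff_isUnit.2
    ((Matrix.isUnit_iff_isUnit_det _).2 (isUnit_iff_ne_zero.2 hdet))
    fun A => momentumPairing m n r (du A.1.1 A.2) σ / volCoeff e η w.1.1
  let c : ℝ := -(volComponent m n r σ + momentumPairing m n r w.1 σ)
  refine ⟨(topVec d, σ + c • volForm m n r), (mem_tangentVectors_W2_iff hm hL hw _).2
    ⟨funext fun A => ?_, ?_⟩, jetProj_topVec d, c, rfl⟩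
  · dsimp only at hd'
    rw [fderiv_momentumConstraint η hL hd, hd', (momentumPairing m n r _).map_add,
      (momentumPairing m n r _).map_smul, momentumPairing_volForm, mul_div_cancel₀ _ hρ]
    simp
  · rw [fderiv_hamiltonian_of_constraint hL hd hG (jetProj_topVec d), apply_holonomicLift,
      (momentumPairing m n r _).map_add, (momentumPairing m n r _).map_smul,
      momentumPairing_volForm, (volComponent m n r).map_add, (volComponent m n r).map_smul,
      volComponent_volForm]
    simp [c]

/-- On `W₂` the form `Ω_{H₀}` restricts to `Ω`, because `H₀` is constant there, and the contraction
of `Ω` with a vector vertical over `J^{k-1} π` is minus the momentum component of that vector. -/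
theorem omegaH_cons_of_tangent [IsManifold 𝓘(ℝ, Base m) ∞ M]
    (hm : 0 < m) (hL : IsSmoothOnJets L) {w : MixedCoord m n r}
    (hw : w ∈ W2 e η L) {v : MixedCoord m n r} (hv : v ∈ tangentVectors (W2 e η L) w)
    (hv0 : jetProj m n r v.1 = 0) {v' : Fin m → MixedCoord m n r}
    (hv' : ∀ a, v' a ∈ tangentVectors (W2 e η L) w) :
    omegaH e η L w (Fin.cons v v') =
      -(v.2 : JetCoord m n r [⋀^Fin m]→L[ℝ] ℝ) (fun b => jetProj m n r (v' b).1) := by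
  have h1 : ∀ a, fderiv ℝ (hamiltonian e η L) w (v' a) = 0 := fun a =>
    ((mem_tangentVectors_W2_iff hm hL hw _).1 (hv' a)).2
  rw [omegaH_cons, ((mem_tangentVectors_W2_iff hm hL hw _).1 hv).2]
  simp only [h1, zero_mul, Finset.sum_const_zero, sub_zero, add_zero]
  rw [Finset.sum_eq_zero, sub_zero]
  · rfl
  · intro a _
    refine ContinuousAlternatingMap.map_coord_zero _ a ?_
    rw [Function.update_self]
    exact hv0

theorem cons_eq_cons_update_comp_swap {α : Type*} (v : α) (v' : Fin m → α) (a : Fin m) :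
    (Fin.cons (v' a) (Function.update v' a v) : Fin (m + 1) → α) =
      (Fin.cons v v' : Fin (m + 1) → α) ∘ Equiv.swap 0 a.succ := by
  funext b
  refine Fin.cases ?_ (fun b => ?_) b
  · simp
  · by_cases hb : b = a
    · subst hb; simp
    · rw [Function.comp_apply, Equiv.swap_apply_of_ne_of_ne (Fin.succ_ne_zero b)
        (fun h => hb (Fin.succ_injective _ h))]
      simp [hb]

/-- The projection to `J^{k-1} π` of a vector in the kernel of `Ω₂` contracts all momenta to zero, up
to multiples of `dᵐx`: the contraction of `Ω` with a tangent vector vertical over `J^{k-1} π` is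
minus its momentum component, and these exhaust the momenta up to multiples of `dᵐx`. -/
theorem apply_eq_zero_of_mem_kernel [IsManifold 𝓘(ℝ, Base m) ∞ M]
    (hm : 0 < m) (hL : IsSmoothOnJets L) {w : MixedCoord m n r}
    (hw : w ∈ W2 e η L) (hdet : (velocityHessian e L w.1).det ≠ 0) {v : MixedCoord m n r}
    (hv : v ∈ tangentVectors (W2 e η L) w)
    (hker : ∀ v' : Fin m → MixedCoord m n r, (∀ a, v' a ∈ tangentVectors (W2 e η L) w) →
      omegaH e η L w (Fin.cons v v') = 0) (σ : Lambda2 m n r) :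
    ∃ c : ℝ, ∀ (y : Fin m → JetCoord m n r) (a : Fin m), y a = jetProj m n r v.1 →
      (σ : JetCoord m n r [⋀^Fin m]→L[ℝ] ℝ) y +
        c * (volForm m n r : JetCoord m n r [⋀^Fin m]→L[ℝ] ℝ) y = 0 := by
  obtain ⟨p, hp, hp0, c, hpc⟩ := exists_vertical_mem_tangentVectors_W2 hm hL hw hdet σ
  refine ⟨c, fun y a hy => ?_⟩
  choose x hx hx1 using fun b => exists_mem_tangentVectors_W2 hm hL hw (jetExt m n r (y b))
  have h1 := hker (Function.update x a p) fun b => by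
    by_cases hb : b = a
    · subst hb; simpa using hp
    · simpa [hb] using hx b
  have h2 := (omegaH e η L w).toAlternatingMap.map_swap (Fin.cons v (Function.update x a p))
    (Fin.succ_ne_zero a).symm
  rw [← cons_eq_cons_update_comp_swap, ContinuousAlternatingMap.coe_toAlternatingMap, h1, neg_zero,
    Function.update_self, Function.update_idem, omegaH_cons_of_tangent hm hL hw hp hp0, hpc] at h2
  · have h3 : (fun b => jetProj m n r (Function.update x a v b).1) = y := by
      funext b
      by_cases hb : b = a
      · subst hb; simp [hy]
      · simp [hb, hx1, jetProj_jetExt]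
    rw [h3] at h2
    exact neg_eq_zero.1 h2
  · intro b
    by_cases hb : b = a
    · subst hb; simpa using hv
    · simpa [hb] using hx b

open Matrix in
/-- For a regular Lagrangian and `m > 1` the kernel of `Ω₂` is trivial. -/
theorem eq_zero_of_mem_kernel [IsManifold 𝓘(ℝ, Base m) ∞ M]
    (hm : 1 < m) (hn : 0 < n) (hL : IsSmoothOnJets L)
    {w : MixedCoord m n r} (hw : w ∈ W2 e η L) (hdet : (velocityHessian e L w.1).det ≠ 0)
    {v : MixedCoord m n r} (hv : v ∈ tangentVectors (W2 e η L) w)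
    (hker : ∀ v' : Fin m → MixedCoord m n r, (∀ a, v' a ∈ tangentVectors (W2 e η L) w) →
      omegaH e η L w (Fin.cons v v') = 0) : v = 0 := by
  have hm0 : 0 < m := by omega
  obtain ⟨hd, hG, -⟩ := (mem_W2_iff hm0 hL).1 hw
  have hρ := volCoeff_ne_zero e η hd
  have key := apply_eq_zero_of_mem_kernel hm0 hL hw hdet hv hker
  -- a momentum `du ∧ dᵐ⁻¹xᵢ` with `i ≠ j` detects the component along `∂/∂xʲ`
  have h1 : (jetProj m n r v.1).1 = 0 := by
    ext j
    obtain ⟨i, hij⟩ : ∃ i : Fin m, i ≠ j := by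
      have : Nontrivial (Fin m) := Fin.nontrivial_iff_two_le.2 hm
      exact exists_ne j
    let I₀ := MultiIdx.zero m r
    let α : Fin n := ⟨0, hn⟩
    obtain ⟨c, hc⟩ := key (momentumForm i (duForm I₀ α))
    have h := hc (fun b => if b = j then jetProj m n r v.1 else if b = i then du I₀ α
      else dxVec m n r b) j (by simp)
    rw [momentumForm_eq_component hij, volForm_eq_zero (a := i)] at h
    · simpa using h
    · simp [hij, du]
    · intro b hbi hbj
      simp [hbi, hbj, dxVec]
    · simp [hij, du]
    · simp [hij, du]
  -- once `v` is vertical over `M`, the momentum `duᵅ_I ∧ dᵐ⁻¹xᵢ` detects its component `u̇ᵅ_I`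
  have h2 : jetProj m n r v.1 = 0 := by
    refine Prod.ext h1 (funext fun I => ?_)
    ext α
    let i : Fin m := ⟨0, hm0⟩
    obtain ⟨c, hc⟩ := key (momentumForm i (duForm I α))
    have h := hc (Function.update (dxVec m n r) i (jetProj m n r v.1)) i (by simp)
    rw [momentumForm_update, volForm_eq_zero (a := i) (by simpa using h1)] at h
    · simpa using h
    · intro b hb
      simp [hb, dxVec]
    · simpa using h1
  have h3 : v.2 = 0 := by
    refine Subtype.ext (ContinuousAlternatingMap.ext fun y => ?_)
    choose x hx hx1 using fun b => exists_mem_tangentVectors_W2 hm0 hL hw (jetExt m n r (y b))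
    have h := hker x hx
    rw [omegaH_cons_of_tangent hm0 hL hw hv h2 hx] at h
    simp only [hx1, jetProj_jetExt] at h
    exact neg_eq_zero.1 h
  have h4 : v = (topVec fun A => v.1.2 A.1.1 A.2, 0) := Prod.ext (eq_topVec h2) h3
  set d := fun A : TopIdx m (r + 1) × Fin n => v.1.2 A.1.1 A.2
  have h5 : d ᵥ* velocityHessian e L w.1 = 0 := by
    funext A
    have := congrFun ((mem_tangentVectors_W2_iff hm0 hL hw _).1 hv).1 A
    rw [h4, fderiv_momentumConstraint η hL hd] at this
    simpa [hρ] using this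
  have h6 : d = 0 := Matrix.eq_zero_of_vecMul_eq_zero hdet h5
  rw [h4, h6]
  simp [topVec]

end W2

end SkinnerRusk

end

theorem mainTheorem2 {m n r : ℕ} (hm : 1 < m) (hn : 0 < n)
    {M E F : Type*}
    [TopologicalSpace M] [ChartedSpace (Base m) M] [IsManifold 𝓘(ℝ, Base m) ∞ M]
    [TopologicalSpace E] [ChartedSpace (Base m × Fib n) E]
    [IsManifold 𝓘(ℝ, Base m × Fib n) ∞ E]
    [TopologicalSpace F] [ChartedSpace (Fib n) F] [IsManifold 𝓘(ℝ, Fib n) ∞ F]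
    (π : E → M) (hπ : IsSmoothFiberBundle (m := m) (n := n) F π)
    (η : VolumeForm m M)
    (L : Jet m n π (r + 1) → ℝ) (hL : IsSmoothOnJets L) :
    IsMultisymplecticOmega2 η L ↔ IsRegularLagrangian L := by
  have hm0 : 0 < m := by omega
  constructor
  · intro h e z hz hdet
    -- a null vector of the Hessian lies in the kernel of `Ω₂`, its momentum component being zero
    obtain ⟨d, hd0, hd⟩ := Matrix.exists_vecMul_eq_zero_iff.2 hdet
    obtain ⟨w, hw, rfl⟩ := exists_mem_W2 (η := η) hm0 hL hz
    obtain ⟨hwd, hG, -⟩ := (mem_W2_iff hm0 hL).1 hw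
    have hv : (topVec d, (0 : Lambda2 m n r)) ∈ tangentVectors (W2 e η L) w := by
      refine (mem_tangentVectors_W2_iff hm0 hL hw _).2 ⟨funext fun A => ?_, ?_⟩
      · rw [fderiv_momentumConstraint η hL hwd, hd]
        simp
      · rw [fderiv_hamiltonian_of_constraint hL hwd hG (jetProj_topVec d)]
        simp
    have h0 := h e w hw _ hv fun v' hv' => by
      rw [omegaH_cons_of_tangent hm0 hL hw hv (jetProj_topVec d) hv']
      simp
    refine hd0 (funext fun A => ?_)
    have h1 : topVec d = 0 := congrArg Prod.fst h0
    rw [← topVec_snd d A, h1]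
    rfl
  · intro h e w hw v hv hker
    exact eq_zero_of_mem_kernel hm hn hL hw (h e w.1 ((mem_W2_iff hm0 hL).1 hw).1) hv hker
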